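/- **Model.** In the synchronous message-passing model, the vertices of an $n$-vertex graph $G$ with maximum degree $\Delta\ge 1$ are processors with distinct identity numbers that are at most $n^{a}$ (for a fixed $a$). Every vertex knows $n$, $\Delta$ and its own identity number. In every round each vertex sends a message to all its neighbors and receives theirs; local computation is free and deterministic. The running time is the number of rounds until all vertices have terminated. Put $\log^{(0)}x=x$, $\log^{(i+1)}x=\log_2\log^{(i)}x$ and $\log^* n=\min\{i : \log^{(i)}n\le 2\}$. A legal $p$-coloring assigns to each vertex one of $p$ colors so that neighbors get different colors. **Procedures.** All procedures run on a graph whose maximum degree is at most $\Lambda$, and colors are numbered $1,2,\dots$. * *Refine*$(p)$, given a (possibly defective) $\chi$-coloring $\varphi$: in increasing order of $\varphi$, each vertex chooses $\psi(v)\in\{1,\dots,p\}$ to be a value chosen by the fewest of its neighbors $u$ with $\varphi(u)<\varphi(v)$; in decreasing order of $\varphi$, it chooses $\Psi(v)\in\{1,\dots,p\}$ in the same way with respect to the neighbors with $\varphi(u)>\varphi(v)$. The new color is $(\Psi(v)-1)p+\psi(v)$. * *Defective-Color*$(p,q)$ with $1\le p$, $p^2<q$, given a legal $\chi$-coloring $\varphi$: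 while $\chi>p^2$, let $h=\max\{\lfloor\chi/q\rfloor,1\}$, put $v$ into the class $V_j$ with $j=\min\{\lceil\varphi(v)/q\rceil,h\}$, run Refine$(p)$ in parallel on the induced subgraphs $G(V_j)$ with the colorings $\varphi-(j-1)q$ (palettes of at most $2q$ colors), add $(j-1)p^2$ to the resulting colors, and set $\chi:=hp^2$. * *KW procedure*, given a legal $m$-coloring: $\lceil\log_2 (m/(\Lambda+1))\rceil$ phases (none if $m\le\Lambda+1$). In each phase the palette is cut into blocks of $2(\Lambda+1)$ colors, and in $\Lambda+1$ rounds the colors of every block are reduced, in parallel, to $\Lambda+1$ colors, by letting one color class after the other choose the smallest color not used by a neighbor in the block. * *Delta-Color*$(G,\Lambda,i,\psi)$, given a legal $c\Lambda^2$-coloring $\psi$: let $k=\lfloor\log^{(i-1)}\Lambda\rfloor$ and $q=\lfloor\Lambda^\varepsilon\rfloor$. If $i\le1$, or if $k\ge1$ and $k^2<q$ do not both hold, apply the KW procedure to $\psi$. Otherwise run Defective-Color$(k,q)$ starting with $\psi$; let $V_1,\dots,V_{k^2}$ be the color classes obtained, $t$ the number of iterations, and $d=t\lfloor\Lambda/k\rfloor$.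 In parallel for all $j$: compute in one round a legal $cd^2$-coloring $\varphi_j$ of $G(V_j)$ from $\psi$, where each vertex $v$ chooses an element of $T_{\psi(v)}$ outside $\bigcup_u T_{\psi(u)}$ over its neighbors $u$ in $V_j$, for a fixed family of $c\Lambda^2$ subsets $T_x$ of $\{1,\dots,cd^2\}$ none of which is contained in the union of $d$ others; then obtain $\varphi'_j$ from Delta-Color$(G(V_j),d,i-1,\varphi_j)$. Finally apply the KW procedure to the legal $k^2(d+1)$-coloring $v\mapsto\varphi'_j(v)+(d+1)(j-1)$ ($v\in V_j$). **Theorem.** There is a positive integer $c$ such that for every $a$ there is a deterministic distributed algorithm (the Szegedy–Vishwanathan algorithm) which computes a legal $c\Delta^2$-coloring $\lambda$ in at most $\frac12\log^* n+K$ rounds, with $K$ depending only on $a$, and such that the following holds for every $\varepsilon\in(0,1)$, with a constant $C$ that depends only on $a$ and $\varepsilon$. For every graph $G$ with $n$ vertices and maximum degree $\Delta\ge1$: 1. running this algorithm and then Delta-Color$(G,\Delta,\log^*\Delta,\lambda)$ computes a legal $(\Delta+1)$-coloring of $G$ within a total of at most $C\Delta+\frac12\log^* n$ rounds; 2. if this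 is followed by Linial's reduction (in $\Delta+1$ rounds, one for each color $s$, the vertices of color $s$ that have no neighbor in the set so far join it), the resulting set is a maximal independent set of $G$, and the total number of rounds is again at most $C\Delta+\frac12\log^* n$. -/

import Mathlib

/-! ## The synchronous message passing model

A message is a finite list of natural numbers (messages of unbounded size are allowed). -/

/-- The program of one processor.  Either it has terminated with an output, or it is about to take
part in one more round: it sends a message to all its neighbours, receives the multiset of the
messages sent by its neighbours in this round, and goes on with a program that may depend on what
it has received.  Programs are deterministic; local computation is free. -/
inductive Program (α : Type) : Type
  | halt : α → Program α
  | comm : List ℕ → (Multiset (List ℕ) → Program α) → Program α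

namespace Program

variable {α β σ : Type}

/-- Sequential composition: when `P` terminates, continue with `f` applied to its output. -/
def bind : Program α → (α → Program β) → Program β
  | halt a, f => f a
  | comm m K, f => comm m fun R => (K R).bind f

instance : Monad Program where
  pure := halt
  bind := Program.bind

/-- One round: send `m` to all neighbours and return the messages received. -/
def exchange (m : List ℕ) : Program (Multiset (List ℕ)) :=
  comm m halt

/-- `loop N body s` executes `body 0`, `body 1`, …, `body (N - 1)` one after the other, starting
with the local state `s`. -/
def loop : ℕ → (ℕ → σ → Program σ) → σ → Program σ
  | 0, _, s => pure s
  | N + 1, body, s => do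
    let s' ← loop N body s
    body N s'

/-- Run a program on the subgraph induced by the vertices that belong to the same class as the
executing vertex, where `j` is the number of the class of the executing vertex: messages are
tagged with `j`, and received messages with a tag different from `j` are ignored.  So the
subgraphs induced by the different classes run the program in parallel. -/
def onClass (j : ℕ) : Program α → Program α
  | halt a => halt a
  | comm m K => comm (j :: m) fun R =>
      onClass j (K (R.filterMap fun msg =>
        if msg.head? = some j then some msg.tail else none))

/-- The message that a program sends in the next round (none if it has terminated). -/
def outgoing : Program α → Option (List ℕ)
  | halt _ => none
  | comm m _ => some m

/-- What is left of a program after a round in which it has received the messages `R`. -/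
def deliver : Program α → Multiset (List ℕ) → Program α
  | halt a, _ => halt a
  | comm _ K, R => K R

end Program

/-- One synchronous round on the network `G`; `P v` is the current program of the processor `v`. -/
def networkRound {V : Type*} [Fintype V] (G : SimpleGraph V) [DecidableRel G.Adj] {α : Type}
    (P : V → Program α) : V → Program α :=
  fun v => (P v).deliver ((G.neighborFinset v).val.filterMap fun u => (P u).outgoing)

/-- A deterministic distributed algorithm: all vertices run the same program, which depends on the
number `n` of vertices, on the maximum degree `Δ`, and on the identity number of the vertex, in
this order. -/
abbrev DistAlgorithm (α : Type) : Type := ℕ → ℕ → ℕ → Program α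

/-- On the network `G` with identity numbers `ident`, the algorithm `A` terminates at every vertex
within `T` rounds, and `out v` is the output of the vertex `v`. -/
def DistAlgorithm.RunsWithin {α : Type} (A : DistAlgorithm α) {V : Type*} [Fintype V]
    (G : SimpleGraph V) [DecidableRel G.Adj] (ident : V → ℕ) (T : ℕ) (out : V → α) : Prop :=
  ∀ v, (networkRound G)^[T] (fun u => A (Fintype.card V) G.maxDegree (ident u)) v
    = Program.halt (out v)

/-- Identity numbers: distinct, and of `O(log n)` bits, i.e. at most `n ^ a`. -/
def IsIdentAssignment {V : Type*} [Fintype V] (a : ℕ) (ident : V → ℕ) : Prop :=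
  Function.Injective ident ∧ ∀ v, ident v ≤ Fintype.card V ^ a

/-- `φ` is a legal `p`-coloring of `G`; the palette is `{0, …, p - 1}`. -/
def IsLegalColoring {V : Type*} (G : SimpleGraph V) (p : ℕ) (φ : V → ℕ) : Prop :=
  (∀ v, φ v < p) ∧ ∀ u v, G.Adj u v → φ u ≠ φ v

/-- `I` is a maximal independent set of `G`. -/
def IsMIS {V : Type*} (G : SimpleGraph V) (I : Set V) : Prop :=
  (∀ u w, G.Adj u w → u ∉ I ∨ w ∉ I) ∧ ∀ v, v ∈ I ∨ ∃ w, G.Adj v w ∧ w ∈ I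

/-- The iterated logarithm `log^{(i)} x` to base `2`. -/
noncomputable def iterLog (i : ℕ) (x : ℝ) : ℝ := (Real.logb 2)^[i] x

/-- `log^* n = min {i | log^{(i)} n ≤ 2}`. -/
noncomputable def logStar (n : ℕ) : ℕ := sInf {i : ℕ | iterLog i (n : ℝ) ≤ 2}

/-! ## The procedures

All palettes are `{0, …, p - 1}`.  Each procedure is given as the program of one vertex. -/

/-- The smallest color of the palette `{0, …, p - 1}` among those that occur in `s` the minimal
number of times. -/
noncomputable def leastUsed (p : ℕ) (s : Multiset ℕ) : ℕ :=
  sInf {x : ℕ | x < p ∧ ∀ y < p, s.count x ≤ s.count y}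

open Program

/-- Procedure Refine, for a vertex of color `φ` in a defective `χ`-coloring.  In round `r` the
vertices of color `r` choose their first color `ψ`, which is the color used by the minimal number
of the neighbours of smaller color; in the same round the vertices of color `χ - 1 - r` choose
their second color `Ψ`, considering the neighbours of larger color.  The result is a color of the
palette `{0, …, p ^ 2 - 1}` that represents the pair `(Ψ, ψ)`. -/
noncomputable def refineProc (χ p φ : ℕ) : Program ℕ := do
  let s ← loop χ (fun r (s : ℕ × ℕ) => do
    let R ← exchange [φ, s.1, s.2]
    let ψ := if φ = r then
        leastUsed p ((R.filter fun m => m.getD 0 0 < φ).map fun m => m.getD 1 0)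
      else s.1
    let Ψ := if φ + r + 1 = χ then
        leastUsed p ((R.filter fun m => φ < m.getD 0 0).map fun m => m.getD 2 0)
      else s.2
    pure (ψ, Ψ)) (0, 0)
  pure (s.2 * p + s.1)

/-- The number of colors after one iteration of Procedure Defective-Color that starts with `χ`
colors. -/
def nextPalette (p q χ : ℕ) : ℕ := max (χ / q) 1 * p ^ 2

/-- The number of iterations of Procedure Defective-Color that starts with `χ` colors: the loop is
left as soon as there are at most `p ^ 2` colors. -/
noncomputable def numIterations (p q χ : ℕ) : ℕ :=
  sInf {t : ℕ | (nextPalette p q)^[t] χ ≤ p ^ 2}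

/-- Procedure Defective-Color with the parameters `p` and `q`, for a vertex of color `φ` in a given
legal `χ`-coloring.  In every iteration the palette is cut into intervals of `q` colors (the last
one has between `q` and `2 * q` colors; there is only one class if there are fewer than `q`
colors), and Procedure Refine is run in parallel on the subgraphs induced by the classes. -/
noncomputable def defectiveColor (p q χ φ : ℕ) : Program ℕ :=
  loop (numIterations p q χ) (fun s φ => do
    let χs := (nextPalette p q)^[s] χ
    let j := min (φ / q) (max (χs / q) 1 - 1)
    let φ' ← onClass j (refineProc (2 * q) p (φ - j * q))
    pure (φ' + j * p ^ 2)) φ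

/-- One phase of the Kuhn–Wattenhofer iterative procedure on a graph of maximum degree at most `Λ`,
for a vertex of color `ψ`.  The palette is cut into blocks of `2 * (Λ + 1)` colors; in parallel,
the colors used in each block are reduced to `Λ + 1` colors within `Λ + 1` rounds, where in round
`s` the vertices of the color `Λ + 1 + s` of the block choose the smallest color that is used by
none of their neighbours in the block. -/
noncomputable def kwPhase (Λ ψ : ℕ) : Program ℕ := do
  let b := ψ / (2 * (Λ + 1))
  let x ← onClass b (loop (Λ + 1) (fun s x => do
    let R ← exchange [x]
    pure (if x = Λ + 1 + s then sInf {y : ℕ | [y] ∉ R} else x)) (ψ % (2 * (Λ + 1))))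
  pure (b * (Λ + 1) + x)

/-- The Kuhn–Wattenhofer iterative procedure: from a legal `m`-coloring `ψ` of a graph of maximum
degree at most `Λ` to a legal `(Λ + 1)`-coloring.  It has `⌈log (m / (Λ + 1))⌉` phases (none if
`m ≤ Λ + 1`) of `Λ + 1` rounds each. -/
noncomputable def kwProc (Λ m ψ : ℕ) : Program ℕ :=
  loop (Nat.clog 2 ((m + Λ) / (Λ + 1))) (fun _ x => kwPhase Λ x) ψ

/-- The sets `T 0, …, T (m - 1)` are subsets of `{0, …, N - 1}`, and none of them is contained in
the union of at most `A` others. -/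
def IsCoverFree (A m N : ℕ) (T : ℕ → Finset ℕ) : Prop :=
  (∀ x < m, T x ⊆ Finset.range N) ∧
    ∀ x < m, ∀ S ⊆ Finset.range m, S.card ≤ A → x ∉ S → ¬ T x ⊆ S.biUnion T

open Classical in
/-- A fixed family with the property `IsCoverFree A m N`, if there is one. -/
noncomputable def coverFreeFamily (A m N : ℕ) : ℕ → Finset ℕ :=
  if h : ∃ T, IsCoverFree A m N T then h.choose else fun _ => ∅

/-- One round that turns a legal `m`-coloring `ψ` of a graph of maximum degree at most `A` into a
legal `N`-coloring: with a cover-free family `T`, choose an element of `T (ψ v)` that lies in none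
of the sets `T (ψ u)` of the neighbours `u`. -/
noncomputable def coverFreeStep (A m N ψ : ℕ) : Program ℕ := do
  let R ← exchange [ψ]
  pure (sInf {y : ℕ | y ∈ coverFreeFamily A m N ψ ∧
    ∀ x, [x] ∈ R → y ∉ coverFreeFamily A m N x})

/-- Procedure Delta-Color with recursion depth `i`, for a vertex of color `ψ` in a given legal
`(c * Λ ^ 2)`-coloring of a graph of maximum degree at most `Λ`.

The bound `d` on the maximum degree of the color classes is the defect that Procedure
Defective-Color guarantees: `⌊Λ / k⌋` for each of its iterations.  The Kuhn–Wattenhofer procedure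
is used directly if `i ≤ 1`, and also if the parameters `p = k` and `q = ⌊Λ ^ ε⌋` violate the
requirements `1 ≤ p` and `p ^ 2 < q` of Procedure Defective-Color. -/
noncomputable def deltaColor (c : ℕ) (ε : ℝ) : ℕ → ℕ → ℕ → Program ℕ
  | 0, Λ, ψ => kwProc Λ (c * Λ ^ 2) ψ
  | 1, Λ, ψ => kwProc Λ (c * Λ ^ 2) ψ
  | i + 2, Λ, ψ =>
    let k := ⌊iterLog (i + 1) (Λ : ℝ)⌋₊
    let q := ⌊(Λ : ℝ) ^ ε⌋₊
    if 1 ≤ k ∧ k ^ 2 < q then do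
      let d := numIterations k q (c * Λ ^ 2) * (Λ / k)
      let j ← defectiveColor k q (c * Λ ^ 2) ψ
      let x ← onClass j (do
        let φ ← coverFreeStep d (c * Λ ^ 2) (c * d ^ 2) ψ
        deltaColor c ε (i + 1) d φ)
      kwProc Λ (k ^ 2 * (d + 1)) (x + (d + 1) * j)
    else kwProc Λ (c * Λ ^ 2) ψ

/-- Linial's reduction: from a legal `(Δ + 1)`-coloring `φ` to a maximal independent set within
`Δ + 1` rounds.  In round `s` the vertices of color `s` without a neighbour in the set join it. -/
noncomputable def misFromColoring (Δ φ : ℕ) : Program Bool :=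
  loop (Δ + 1) (fun s (b : Bool) => do
    let R ← exchange [if b then 1 else 0]
    pure (if φ = s then decide ([1] ∉ R) else b)) false

/-- The coloring algorithm: first the algorithm `sv`, which is to compute a
`(c * Δ ^ 2)`-coloring, then Procedure Delta-Color with `Λ = Δ` and recursion depth `log^* Δ`. -/
noncomputable def deltaColorAlgorithm (c : ℕ) (ε : ℝ) (sv : DistAlgorithm ℕ) : DistAlgorithm ℕ :=
  fun n Δ x => do
    let ψ ← sv n Δ x
    deltaColor c ε (logStar Δ) Δ ψ

/-- The coloring algorithm, followed by Linial's reduction. -/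
noncomputable def misAlgorithm (c : ℕ) (ε : ℝ) (sv : DistAlgorithm ℕ) : DistAlgorithm Bool :=
  fun n Δ x => do
    let φ ← deltaColorAlgorithm c ε sv n Δ x
    misFromColoring Δ φ

/-- `sv` has the properties of the Szegedy–Vishwanathan algorithm: it computes a legal
`(c * Δ ^ 2)`-coloring of every graph with maximum degree `Δ ≥ 1`, within `(1 / 2) log^* n + K`
rounds; identity numbers are at most `n ^ a`. -/
def IsSVAlgorithm (c a : ℕ) (K : ℝ) (sv : DistAlgorithm ℕ) : Prop :=
  ∀ (V : Type) [Fintype V] (G : SimpleGraph V) [DecidableRel G.Adj] (ident : V → ℕ),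
    IsIdentAssignment a ident → 1 ≤ G.maxDegree →
    ∃ (T : ℕ) (out : V → ℕ), (T : ℝ) ≤ (1 / 2) * logStar (Fintype.card V) + K ∧
      sv.RunsWithin G ident T out ∧ IsLegalColoring G (c * G.maxDegree ^ 2) out

/-! Every procedure lasts a number of rounds that depends only on its parameters, so all vertices
stay in step and durations add up under sequential composition. Correctness and running time can
then be treated separately.

Correctness. One iteration of Defective-Color adds at most `Λ / k` to the defect, because each of
the two choices in Refine obeys the pigeonhole principle. Hence the classes have degree at most `d`.
Since at least two iterations take place, `Λ ≤ d * k`, and with `k ^ 2 < q ≤ Λ` this gives `Λ ≤ d ^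
2`. The cover-free families needed for the recursive call then exist: they are graphs of polynomials
of degree at most 4 over a prime field, and this is the source of `c = 64`.

Running time of Delta-Color. The number of iterations is bounded by some `B` depending on `ε`, as
each of them divides a large palette by a power of `Λ`. Let `y` be the iterated logarithm of `Λ`
whose floor is `k`. A level costs `Λ * (2 * log y + O(1))`, and the recursive call works with `d ≤ B
* Λ / k`. The corresponding quantity `y'` for `d` satisfies `log y' ≤ y + log B`, so the logarithmic
term of the next level is absorbed by the division by `k`. Moreover `y' ≥ y + 1`, so the factor `2 *
B / y` eventually becomes small; `levelWeight` pays for the boundedly many levels before that. At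
the top `log y ≤ 2` by the choice of the depth, so the total is `O(Λ)` (`exists_deltaTime_le`).

The initial coloring. In one round an arc is colored by the lowest bit in which its ends differ,
then chooses an element of a cover-free family avoiding the arcs that precede it, and a vertex takes
the set of choices of its outgoing arcs as its new color. This takes two logarithms at once, whence
the factor 1/2 before `log^* n`. Once the palette is a tower of fixed height over `Δ`, six rounds of
Linial's reduction finish. -/

/-! ### Lockstep executions and their composition -/

/-- A lockstep execution of exactly `T` rounds: `N v` is the set of neighbours of `v`, all vertices
take part in every one of the `T` rounds, and then they all terminate, with outputs `out v`. -/
def RunsIn {V : Type} {α : Type} (N : V → Finset V) : ℕ → (V → Program α) → (V → α) → Prop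
  | 0, P, out => ∀ v, P v = halt (out v)
  | T + 1, P, out => ∃ (m : V → List ℕ) (K : V → Multiset (List ℕ) → Program α),
      (∀ v, P v = comm (m v) (K v)) ∧ RunsIn N T (fun v => K v ((N v).val.map m)) out

namespace RunsIn

variable {V α β σ : Type} {N : V → Finset V}

theorem pure (out : V → α) : RunsIn N 0 (fun v => (Pure.pure (out v) : Program α)) out :=
  fun _ => rfl

theorem bind {T T' : ℕ} {P : V → Program α} {out : V → α} {f : V → α → Program β}
    {out' : V → β} (h : RunsIn N T P out) (h' : RunsIn N T' (fun v => f v (out v)) out') :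
    RunsIn N (T + T') (fun v => P v >>= f v) out' := by
  induction T generalizing P with
  | zero =>
    have : (fun v => P v >>= f v) = fun v => f v (out v) := by
      funext v; rw [h v]; rfl
    rw [this, Nat.zero_add]; exact h'
  | succ T ih =>
    obtain ⟨m, K, hP, hr⟩ := h
    rw [Nat.succ_add]
    refine ⟨m, fun v R => K v R >>= f v, fun v => ?_, ih hr⟩
    show P v >>= f v = _
    rw [hP v]; rfl

theorem bind_pure {T : ℕ} {P : V → Program α} {out : V → α} (h : RunsIn N T P out)
    (f : V → α → β) :
    RunsIn N T (fun v => P v >>= fun x => Pure.pure (f v x)) (fun v => f v (out v)) :=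
  h.bind (f := fun v x => Pure.pure (f v x)) (pure _)

theorem exchange_bind {T : ℕ} {m : V → List ℕ} {f : V → Multiset (List ℕ) → Program β}
    {out : V → β} (h : RunsIn N T (fun v => f v ((N v).val.map m)) out) :
    RunsIn N (T + 1) (fun v => exchange (m v) >>= f v) out :=
  ⟨m, f, fun _ => rfl, h⟩

theorem exchange_pure (m : V → List ℕ) (f : V → Multiset (List ℕ) → β) :
    RunsIn N 1 (fun v => exchange (m v) >>= fun R => Pure.pure (f v R))
      (fun v => f v ((N v).val.map m)) :=
  exchange_bind (f := fun v R => Pure.pure (f v R)) (pure _)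

theorem loop (Inv : ℕ → (V → σ) → Prop) {n t : ℕ} {body : V → ℕ → σ → Program σ}
    (hbody : ∀ r < n, ∀ s, Inv r s →
      ∃ s', RunsIn N t (fun v => body v r (s v)) s' ∧ Inv (r + 1) s')
    {s : V → σ} (hs : Inv 0 s) :
    ∃ s', RunsIn N (n * t) (fun v => loop n (body v) (s v)) s' ∧ Inv n s' := by
  induction n with
  | zero => exact ⟨s, by rw [Nat.zero_mul]; exact fun _ => rfl, hs⟩
  | succ n ih =>
    obtain ⟨s₁, h₁, hI₁⟩ := ih fun r hr => hbody r (hr.trans (Nat.lt_succ_self n))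
    obtain ⟨s₂, h₂, hI₂⟩ := hbody n (Nat.lt_succ_self n) s₁ hI₁
    refine ⟨s₂, ?_, hI₂⟩
    rw [Nat.succ_mul]
    exact h₁.bind (f := fun v x => body v n x) h₂

/-- Running on all classes at once amounts to shrinking the neighbourhoods, which is why executions
are stated for a neighbourhood function instead of a graph. -/
theorem onClass {T : ℕ} {j : V → ℕ} {P : V → Program α} {out : V → α}
    (h : RunsIn (fun v => (N v).filter fun u => j u = j v) T P out) :
    RunsIn N T (fun v => onClass (j v) (P v)) out := by
  induction T generalizing P with
  | zero => intro v; show Program.onClass (j v) (P v) = _; rw [h v]; rfl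
  | succ T ih =>
    obtain ⟨m, K, hP, hr⟩ := h
    refine ⟨fun v => j v :: m v, fun v R => Program.onClass (j v) (K v (R.filterMap fun msg =>
        if msg.head? = some (j v) then some msg.tail else none)), fun v => ?_, ?_⟩
    · show Program.onClass (j v) (P v) = _
      rw [hP v]; rfl
    · have key := ih hr
      convert key using 4 with v
      -- Discarding messages with a foreign tag leaves exactly the messages of the neighbours in the
      -- same class.
      rw [Multiset.filterMap_map, Finset.filter_val]
      induction (N v).val using Multiset.induction_on with
      | empty => simp
      | cons a s ihs =>
        by_cases ha : j a = j v
        · rw [Multiset.filter_cons_of_pos (p := fun u => j u = j v) _ ha, Multiset.map_cons, ← ihs,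
            Multiset.filterMap_cons_some _ a s (b := m a) (by simp [ha])]
        · rw [Multiset.filter_cons_of_neg (p := fun u => j u = j v) _ ha, ← ihs,
            Multiset.filterMap_cons_none a s (by simp [ha])]

/-- The link to the model: in lockstep no neighbour has terminated early, so each of them
contributes a message. -/
theorem iterate_networkRound [Fintype V] {G : SimpleGraph V} [DecidableRel G.Adj] {T : ℕ}
    {P : V → Program α} {out : V → α} (h : RunsIn (fun v => G.neighborFinset v) T P out) (v : V) :
    (networkRound G)^[T] P v = halt (out v) := by
  induction T generalizing P with
  | zero => exact h v
  | succ T ih =>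
    obtain ⟨m, K, hP, hr⟩ := h
    rw [Function.iterate_succ_apply]
    have : networkRound G P = fun v => K v ((G.neighborFinset v).val.map m) := by
      funext v
      have hm : (fun u => (P u).outgoing) = fun u => some (m u) := by
        funext u; rw [hP u]; rfl
      simp only [networkRound, hm, hP v, deliver]
      congr 1
      exact congrFun (Multiset.filterMap_eq_map m) _
    rw [this]
    exact ih hr

end RunsIn

/-! ### Networks and legal colorings relative to a neighbourhood function -/

/-- `N` is the neighbourhood function of an undirected graph of maximum degree at most `Λ`. -/
structure IsNetwork {V : Type} (N : V → Finset V) (Λ : ℕ) : Prop where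
  symm : ∀ u v, u ∈ N v → v ∈ N u
  card_le : ∀ v, (N v).card ≤ Λ

/-- `φ` is a legal `p`-coloring with respect to the neighbourhood function `N`. -/
structure IsLegal {V : Type} (N : V → Finset V) (p : ℕ) (φ : V → ℕ) : Prop where
  lt : ∀ v, φ v < p
  ne : ∀ v, ∀ u ∈ N v, φ u ≠ φ v

section

variable {V : Type} {N : V → Finset V} {Λ p : ℕ}

theorem IsNetwork.filter (h : IsNetwork N Λ) (j : V → ℕ) :
    IsNetwork (fun v => (N v).filter fun u => j u = j v) Λ where
  symm u v huv := by
    rw [Finset.mem_filter] at huv ⊢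
    exact ⟨h.symm u v huv.1, huv.2.symm⟩
  card_le v := (Finset.card_filter_le _ _).trans (h.card_le v)

theorem IsLegal.filter {φ : V → ℕ} (h : IsLegal N p φ) (j : V → ℕ) :
    IsLegal (fun v => (N v).filter fun u => j u = j v) p φ where
  lt := h.lt
  ne v u hu := h.ne v u (Finset.mem_filter.1 hu).1

theorem IsLegal.mono {φ : V → ℕ} {p' : ℕ} (h : IsLegal N p φ) (hp : p ≤ p') :
    IsLegal N p' φ where
  lt v := (h.lt v).trans_le hp
  ne := h.ne

theorem SimpleGraph.isNetwork [Fintype V] (G : SimpleGraph V) [DecidableRel G.Adj] :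
    IsNetwork (fun v => G.neighborFinset v) G.maxDegree where
  symm u v huv := by
    rw [SimpleGraph.mem_neighborFinset] at huv ⊢
    exact huv.symm
  card_le v := G.degree_le_maxDegree v

theorem isLegal_neighborFinset_iff [Fintype V] (G : SimpleGraph V) [DecidableRel G.Adj]
    (φ : V → ℕ) :
    IsLegal (fun v => G.neighborFinset v) p φ ↔ IsLegalColoring G p φ := by
  constructor
  · exact fun h => ⟨h.lt, fun u v huv => h.ne v u ((G.mem_neighborFinset _ _).2 huv.symm)⟩
  · exact fun h => ⟨h.1, fun v u hu => h.2 u v (((G.mem_neighborFinset _ _).1 hu).symm)⟩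

end

/-! ### Procedure Refine -/

section LeastUsed

variable {p : ℕ} (s : Multiset ℕ)

theorem leastUsed_spec (hp : 0 < p) :
    leastUsed p s < p ∧ ∀ y < p, s.count (leastUsed p s) ≤ s.count y := by
  obtain ⟨x, hx, hmin⟩ := (Finset.range p).exists_min_image (fun x => s.count x)
    ⟨0, Finset.mem_range.2 hp⟩
  exact Nat.sInf_mem (s := {x : ℕ | x < p ∧ ∀ y < p, s.count x ≤ s.count y})
    ⟨x, Finset.mem_range.1 hx, fun y hy => hmin y (Finset.mem_range.2 hy)⟩

theorem count_leastUsed_le (hp : 0 < p) : s.count (leastUsed p s) ≤ s.card / p := by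
  rw [Nat.le_div_iff_mul_le hp, mul_comm]
  calc p * s.count (leastUsed p s)
      = ∑ _y ∈ Finset.range p, s.count (leastUsed p s) := by simp
    _ ≤ ∑ y ∈ Finset.range p, s.count y :=
        Finset.sum_le_sum fun y hy => (leastUsed_spec s hp).2 y (Finset.mem_range.1 hy)
    -- Elements of `s` outside the palette are included so that the sum counts all of `s`.
    _ ≤ ∑ y ∈ Finset.range p ∪ s.toFinset, s.count y :=
        Finset.sum_le_sum_of_subset Finset.subset_union_left
    _ = s.card := Multiset.sum_count_eq_card fun y hy =>
        Finset.mem_union_right _ (Multiset.mem_toFinset.2 hy)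

end LeastUsed

section Refine

variable {V : Type} {N : V → Finset V}

/-- The local computation of a vertex in a round of Procedure Refine. -/
noncomputable def refineUpdate (χ p φ r : ℕ) (s : ℕ × ℕ) (R : Multiset (List ℕ)) : ℕ × ℕ :=
  (if φ = r then leastUsed p ((R.filter fun m => m.getD 0 0 < φ).map fun m => m.getD 1 0)
    else s.1,
  if φ + r + 1 = χ then leastUsed p ((R.filter fun m => φ < m.getD 0 0).map fun m => m.getD 2 0)
    else s.2)

theorem refineProc_eq (χ p φ : ℕ) : refineProc χ p φ =
    loop χ (fun r s => exchange [φ, s.1, s.2] >>= fun R => pure (refineUpdate χ p φ r s R)) (0, 0)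
      >>= fun s => pure (s.2 * p + s.1) :=
  rfl

/-- The state of Procedure Refine before round `r`. -/
structure RefineInvariant (N : V → Finset V) (χ p : ℕ) (φ : V → ℕ) (r : ℕ) (s : V → ℕ × ℕ) :
    Prop where
  fst_lt : ∀ v, (s v).1 < p
  snd_lt : ∀ v, (s v).2 < p
  fst_eq : ∀ v, φ v < r → (s v).1 =
    leastUsed p (((N v).filter fun u => φ u < φ v).val.map fun u => (s u).1)
  snd_eq : ∀ v, χ ≤ φ v + r → (s v).2 =
    leastUsed p (((N v).filter fun u => φ v < φ u).val.map fun u => (s u).2)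

/-- The equations speak of the current values of the neighbours, yet they persist: the values on
their right-hand sides were fixed in earlier rounds and are not touched in round `r`. -/
theorem RefineInvariant.step {χ p r : ℕ} (hp : 0 < p) {φ : V → ℕ} {s s' : V → ℕ × ℕ}
    (h : RefineInvariant N χ p φ r s)
    (hs' : ∀ v, s' v = refineUpdate χ p (φ v) r (s v)
      ((N v).val.map fun u => [φ u, (s u).1, (s u).2])) :
    RefineInvariant N χ p φ (r + 1) s' where
  fst_lt v := by
    rw [hs', refineUpdate]
    dsimp only
    split_ifs
    exacts [(leastUsed_spec _ hp).1, h.fst_lt v]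
  snd_lt v := by
    rw [hs', refineUpdate]
    dsimp only
    split_ifs
    exacts [(leastUsed_spec _ hp).1, h.snd_lt v]
  fst_eq v hv := by
    have hcongr : (((N v).filter fun u => φ u < φ v).val.map fun u => (s' u).1) =
        ((N v).filter fun u => φ u < φ v).val.map fun u => (s u).1 := by
      refine Multiset.map_congr rfl fun u hu => ?_
      have hu' : φ u < φ v := (Finset.mem_filter.1 hu).2
      rw [hs', refineUpdate]
      exact if_neg (by omega)
    rw [hcongr, hs', refineUpdate]
    dsimp only
    split_ifs with hr
    · rw [Multiset.filter_map, Multiset.map_map]; rfl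
    · exact h.fst_eq v (by omega)
  snd_eq v hv := by
    have hcongr : (((N v).filter fun u => φ v < φ u).val.map fun u => (s' u).2) =
        ((N v).filter fun u => φ v < φ u).val.map fun u => (s u).2 := by
      refine Multiset.map_congr rfl fun u hu => ?_
      have hu' : φ v < φ u := (Finset.mem_filter.1 hu).2
      rw [hs', refineUpdate]
      exact if_neg (by omega)
    rw [hcongr, hs', refineUpdate]
    dsimp only
    split_ifs with hr
    · rw [Multiset.filter_map, Multiset.map_map]; rfl
    · exact h.snd_eq v (by omega)

/-- A neighbour with the same pair agrees with `v` in both components. Those of smaller color are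
bounded through the first component and those of larger color through the second, each by a fraction
`1 / p`. Neighbours of equal color take no part in the choices and are left to the caller. -/
theorem exists_runsIn_refineProc {χ p Λ : ℕ} (hp : 0 < p) {φ : V → ℕ} (hφ : ∀ v, φ v < χ)
    (hN : ∀ v, (N v).card ≤ Λ) :
    ∃ out : V → ℕ, RunsIn N χ (fun v => refineProc χ p (φ v)) out ∧ (∀ v, out v < p ^ 2) ∧
      ∀ v, ((N v).filter fun u => φ u ≠ φ v ∧ out u = out v).card ≤ Λ / p := by
  obtain ⟨s, hs, hlt1, hlt2, hlo, hhi⟩ := RunsIn.loop (N := N) (n := χ) (t := 1)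
    (body := fun v r s => exchange [φ v, s.1, s.2] >>=
      fun R => pure (refineUpdate χ p (φ v) r s R))
    (RefineInvariant N χ p φ)
    (fun r _ s h => ⟨_, RunsIn.exchange_pure (fun v => [φ v, (s v).1, (s v).2])
      (fun v R => refineUpdate χ p (φ v) r (s v) R), h.step hp fun _ => rfl⟩)
    (s := fun _ => (0, 0))
    ⟨fun _ => hp, fun _ => hp, fun v hv => absurd hv (by omega),
      fun v hv => absurd (hφ v) (by omega)⟩
  simp only [refineProc_eq]
  rw [mul_one] at hs
  refine ⟨fun v => (s v).2 * p + (s v).1, hs.bind_pure (fun _ s => s.2 * p + s.1), fun v => ?_,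
    fun v => ?_⟩
  · have h1 := hlt1 v
    have h2 : ((s v).2 + 1) * p ≤ p * p := Nat.mul_le_mul_right _ (hlt2 v)
    dsimp only
    nlinarith
  · classical
    set a := (N v).filter fun u => φ u < φ v
    set b := (N v).filter fun u => φ v < φ u
    have hsub : ((N v).filter fun u => φ u ≠ φ v ∧
        (s u).2 * p + (s u).1 = (s v).2 * p + (s v).1) ⊆
        (a.filter fun u => (s v).1 = (s u).1) ∪ b.filter fun u => (s v).2 = (s u).2 := by
      intro u hu
      obtain ⟨huN, hne, heq⟩ := Finset.mem_filter.1 hu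
      have h1 : (s v).1 = (s u).1 := by
        have := congrArg (· % p) heq
        simpa [Nat.mul_add_mod_self_right, Nat.mod_eq_of_lt (hlt1 u),
          Nat.mod_eq_of_lt (hlt1 v)] using this.symm
      have h2 : (s v).2 = (s u).2 := by
        rw [h1] at heq
        exact (Nat.eq_of_mul_eq_mul_right hp (Nat.add_right_cancel heq)).symm
      rw [Finset.mem_union, Finset.mem_filter, Finset.mem_filter, Finset.mem_filter,
        Finset.mem_filter]
      rcases lt_or_gt_of_ne hne with h | h
      · exact Or.inl ⟨⟨huN, h⟩, h1⟩
      · exact Or.inr ⟨⟨huN, h⟩, h2⟩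
    have ha : (a.filter fun u => (s v).1 = (s u).1).card ≤ a.card / p := by
      have := count_leastUsed_le (a.val.map fun u => (s u).1) hp
      rw [← hlo v (hφ v), Multiset.count_map, Multiset.card_map] at this
      exact this
    have hb : (b.filter fun u => (s v).2 = (s u).2).card ≤ b.card / p := by
      have := count_leastUsed_le (b.val.map fun u => (s u).2) hp
      rw [← hhi v (by omega), Multiset.count_map, Multiset.card_map] at this
      exact this
    have hab : a.card + b.card ≤ Λ := by
      rw [← Finset.card_union_of_disjoint]
      · exact (Finset.card_le_card (Finset.union_subset (Finset.filter_subset _ _)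
          (Finset.filter_subset _ _))).trans (hN v)
      · rw [Finset.disjoint_left]
        intro u hu hu'
        exact absurd (Finset.mem_filter.1 hu).2 (Finset.mem_filter.1 hu').2.not_gt
    calc _ ≤ _ := Finset.card_le_card hsub
      _ ≤ _ := Finset.card_union_le _ _
      _ ≤ a.card / p + b.card / p := add_le_add ha hb
      _ ≤ (a.card + b.card) / p := Nat.div_add_div_le_add_div
      _ ≤ Λ / p := Nat.div_le_div_right hab

end Refine

/-! ### Procedure Defective-Color -/

section DefectiveColor

theorem nextPalette_lt {p q χ : ℕ} (hpq : p ^ 2 < q) (hχ : p ^ 2 < χ) :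
    nextPalette p q χ < χ := by
  unfold nextPalette
  rcases le_total (χ / q) 1 with h | h
  · rwa [max_eq_right h, one_mul]
  · rw [max_eq_left h]
    calc χ / q * p ^ 2 < χ / q * q := Nat.mul_lt_mul_of_pos_left hpq h
      _ ≤ χ := Nat.div_mul_le_self _ _

theorem exists_iterate_nextPalette_le {p q : ℕ} (hpq : p ^ 2 < q) (χ : ℕ) :
    ∃ t ≤ χ, (nextPalette p q)^[t] χ ≤ p ^ 2 := by
  induction χ using Nat.strong_induction_on with
  | _ χ ih =>
    by_cases h : χ ≤ p ^ 2
    · exact ⟨0, Nat.zero_le _, h⟩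
    · have hlt := nextPalette_lt hpq (not_le.1 h)
      obtain ⟨t, ht, htp⟩ := ih _ hlt
      exact ⟨t + 1, by omega, htp⟩

theorem iterate_numIterations_le {p q : ℕ} (hpq : p ^ 2 < q) (χ : ℕ) :
    (nextPalette p q)^[numIterations p q χ] χ ≤ p ^ 2 :=
  Nat.sInf_mem (s := {t : ℕ | (nextPalette p q)^[t] χ ≤ p ^ 2})
    ((exists_iterate_nextPalette_le hpq χ).imp fun _ h => h.2)

theorem numIterations_le {p q : ℕ} (hpq : p ^ 2 < q) (χ : ℕ) : numIterations p q χ ≤ χ := by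
  obtain ⟨t, ht, h⟩ := exists_iterate_nextPalette_le hpq χ
  exact (Nat.sInf_le (s := {t : ℕ | (nextPalette p q)^[t] χ ≤ p ^ 2}) h).trans ht

variable {V : Type} {N : V → Finset V}

theorem exists_runsIn_defectiveColor {p q χ Λ : ℕ} (hp : 0 < p) (hpq : p ^ 2 < q) {φ : V → ℕ}
    (hN : ∀ v, (N v).card ≤ Λ) (hφ : IsLegal N χ φ) :
    ∃ out : V → ℕ,
      RunsIn N (numIterations p q χ * (2 * q)) (fun v => defectiveColor p q χ (φ v)) out ∧
      (∀ v, out v < p ^ 2) ∧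
      ∀ v, ((N v).filter fun u => out u = out v).card ≤ numIterations p q χ * (Λ / p) := by
  have hq : 0 < q := by omega
  obtain ⟨s, hs, hlt, hdef⟩ := RunsIn.loop (N := N) (n := numIterations p q χ) (t := 2 * q)
    (σ := ℕ)
    (body := fun _ s (φ : ℕ) => (do
      let χs := (nextPalette p q)^[s] χ
      let j := min (φ / q) (max (χs / q) 1 - 1)
      let φ' ← onClass j (refineProc (2 * q) p (φ - j * q))
      Pure.pure (φ' + j * p ^ 2)))
    (fun r s => (∀ v, s v < (nextPalette p q)^[r] χ) ∧
      ∀ v, ((N v).filter fun u => s u = s v).card ≤ r * (Λ / p))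
    (by
      rintro r - s ⟨hlt, hdef⟩
      set χs := (nextPalette p q)^[r] χ with hχs
      set h := max (χs / q) 1 with hh
      have hpos : 1 ≤ h := le_max_right _ _
      let j : V → ℕ := fun v => min (s v / q) (h - 1)
      have hjq : ∀ v, j v * q ≤ s v := fun v =>
        (Nat.mul_le_mul_right q (min_le_left _ _)).trans (Nat.div_mul_le_self _ _)
      obtain ⟨out, hrun, hout, hcard⟩ := exists_runsIn_refineProc
        (N := fun v => (N v).filter fun u => j u = j v) (χ := 2 * q) (φ := fun v => s v - j v * q)
        hp (by
          intro v
          have h1 := hlt v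
          have h2 : χs < (χs / q + 1) * q := Nat.lt_mul_of_div_lt (Nat.lt_succ_self _) hq
          have h3 : χs / q ≤ h := le_max_left _ _
          have h4 : (χs / q + 1) * q ≤ (h + 1) * q := Nat.mul_le_mul_right _ (by omega)
          have h6 : χs < (h + 1) * q := h2.trans_le h4
          -- The last class absorbs the remainder of the division and may hold nearly `2 * q`
          -- colors; hence the palette on which Refine is run.
          rcases le_total (s v / q) (h - 1) with h5 | h5
          · have hj : j v = s v / q := min_eq_left h5
            have := Nat.lt_mul_of_div_lt (Nat.lt_succ_self (s v / q)) hq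
            rw [Nat.succ_mul] at this
            rw [hj]
            omega
          · have hj : j v = h - 1 := min_eq_right h5
            rw [hj]
            obtain ⟨g, hg⟩ := Nat.exists_eq_add_of_le' hpos
            rw [hg] at h6 ⊢
            simp only [Nat.add_sub_cancel, add_mul] at h6 ⊢
            omega)
        (fun v => (Finset.card_filter_le _ _).trans (hN v))
      refine ⟨fun v => out v + j v * p ^ 2,
        (RunsIn.onClass hrun).bind_pure (fun v x => x + j v * p ^ 2), ?_, ?_⟩
      · intro v
        rw [Function.iterate_succ_apply', ← hχs]
        have h1 := hout v
        have h2 : j v + 1 ≤ h := by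
          have : j v ≤ h - 1 := min_le_right _ _
          omega
        have h3 := Nat.mul_le_mul_right (p ^ 2) h2
        rw [add_mul] at h3
        show out v + j v * p ^ 2 < h * p ^ 2
        omega
      · intro v
        classical
        -- Equal new colors force equal classes. Such a neighbour either had the same old color and
        -- belongs to the old defect, or is counted by Refine, so the defect grows additively.
        have hsub : ((N v).filter fun u => out u + j u * p ^ 2 = out v + j v * p ^ 2) ⊆
            ((N v).filter fun u => s u = s v) ∪
            (((N v).filter fun u => j u = j v).filter fun u =>
              s u - j u * q ≠ s v - j v * q ∧ out u = out v) := by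
          intro u hu
          obtain ⟨huN, heq⟩ := Finset.mem_filter.1 hu
          have hp2 : 0 < p ^ 2 := by positivity
          have hj : j u = j v := by
            have := congrArg (· / p ^ 2) heq
            simpa [Nat.add_mul_div_right _ _ hp2, Nat.div_eq_of_lt (hout u),
              Nat.div_eq_of_lt (hout v)] using this
          have ho : out u = out v := by rw [hj] at heq; exact Nat.add_right_cancel heq
          rw [Finset.mem_union, Finset.mem_filter, Finset.mem_filter, Finset.mem_filter]
          by_cases hsv : s u = s v
          · exact Or.inl ⟨huN, hsv⟩
          · refine Or.inr ⟨⟨huN, hj⟩, ?_, ho⟩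
            have h1 := hjq u
            have h2 := hjq v
            rw [hj] at h1 ⊢
            omega
        calc _ ≤ _ := Finset.card_le_card hsub
          _ ≤ _ := Finset.card_union_le _ _
          _ ≤ r * (Λ / p) + Λ / p := add_le_add (hdef v) (hcard v)
          _ = (r + 1) * (Λ / p) := by ring)
    (s := φ)
    ⟨hφ.lt, fun v => by
      rw [zero_mul, Nat.le_zero, Finset.card_eq_zero, Finset.filter_eq_empty_iff]
      exact hφ.ne v⟩
  exact ⟨s, hs, fun v => (hlt v).trans_le (iterate_numIterations_le hpq χ), hdef⟩

end DefectiveColor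

/-! ### The Kuhn–Wattenhofer procedure -/

section KW

variable {V : Type} {N : V → Finset V}

theorem sInf_notMem_map_singleton_spec {Λ : ℕ} {S : Finset V} (hS : S.card ≤ Λ) (x : V → ℕ) :
    sInf {y : ℕ | [y] ∉ S.val.map fun u => [x u]} ≤ Λ ∧
      ∀ u ∈ S, x u ≠ sInf {y : ℕ | [y] ∉ S.val.map fun u => [x u]} := by
  have hmem : ∀ y : ℕ, y ∈ {y : ℕ | [y] ∉ S.val.map fun u => [x u]} ↔ y ∉ S.image x := by
    intro y
    simp
  obtain ⟨y, hy, hyS⟩ : ∃ y ∈ Finset.range (Λ + 1), y ∉ S.image x := by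
    by_contra! hcon
    have h1 := Finset.card_le_card (show Finset.range (Λ + 1) ⊆ S.image x from hcon)
    have h2 := Finset.card_image_le (s := S) (f := x)
    rw [Finset.card_range] at h1
    omega
  have hne := (hmem y).2 hyS
  constructor
  · exact (Nat.sInf_le hne).trans (Nat.lt_succ_iff.1 (Finset.mem_range.1 hy))
  · intro u hu heq
    exact (hmem _).1 (Nat.sInf_mem ⟨y, hne⟩) (heq ▸ Finset.mem_image_of_mem x hu)

theorem exists_runsIn_kwBlock {Λ : ℕ} (hN : IsNetwork N Λ) {φ : V → ℕ}
    (hφ : IsLegal N (2 * (Λ + 1)) φ) :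
    ∃ out : V → ℕ,
      RunsIn N (Λ + 1) (fun v => loop (Λ + 1) (fun s x => (do
        let R ← exchange [x]
        pure (if x = Λ + 1 + s then sInf {y : ℕ | [y] ∉ R} else x))) (φ v)) out ∧
      IsLegal N (Λ + 1) out := by
  obtain ⟨out, hout, hlt, hne⟩ := RunsIn.loop (N := N) (n := Λ + 1) (t := 1)
    (body := fun _ s x => exchange [x] >>= fun R =>
      pure (if x = Λ + 1 + s then sInf {y : ℕ | [y] ∉ R} else x))
    (fun s x => (∀ v, x v ≤ Λ ∨ Λ + 1 + s ≤ x v ∧ x v < 2 * (Λ + 1)) ∧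
      ∀ v, ∀ u ∈ N v, x u ≠ x v)
    (by
      rintro s - x ⟨hlt, hne⟩
      refine ⟨_, RunsIn.exchange_pure (fun v => [x v]) (fun v R =>
        if x v = Λ + 1 + s then sInf {y : ℕ | [y] ∉ R} else x v), ?_, ?_⟩
      · intro v
        have h1 := hlt v
        have h2 := (sInf_notMem_map_singleton_spec (hN.card_le v) x).1
        split_ifs
        · exact Or.inl h2
        · omega
      · intro v u hu
        have h1 := (sInf_notMem_map_singleton_spec (hN.card_le v) x).2 u hu
        have h2 := (sInf_notMem_map_singleton_spec (hN.card_le u) x).2 v (hN.symm u v hu)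
        have h3 := hne v u hu
        -- Two vertices that recolor in the same round have equal old colors and hence are not
        -- adjacent.
        split_ifs with h4 h5 h5
        · omega
        · exact h2.symm
        · exact h1
        · exact h3)
    (s := φ) ⟨fun v => by have := hφ.lt v; omega, hφ.ne⟩
  rw [mul_one] at hout
  exact ⟨out, hout, fun v => by have := hlt v; omega, hne⟩

theorem exists_runsIn_kwPhase {Λ M : ℕ} (hN : IsNetwork N Λ) {φ : V → ℕ}
    (hφ : IsLegal N (2 * M * (Λ + 1)) φ) :
    ∃ out : V → ℕ, RunsIn N (Λ + 1) (fun v => kwPhase Λ (φ v)) out ∧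
      IsLegal N (M * (Λ + 1)) out := by
  have hpos : 0 < 2 * (Λ + 1) := by omega
  obtain ⟨x, hx, hlegal⟩ := exists_runsIn_kwBlock (hN.filter fun v => φ v / (2 * (Λ + 1)))
    (φ := fun v => φ v % (2 * (Λ + 1)))
    { lt := fun v => Nat.mod_lt _ hpos
      ne := fun v u hu heq => by
        obtain ⟨huN, hb⟩ := Finset.mem_filter.1 hu
        refine hφ.ne v u huN ?_
        rw [← Nat.div_add_mod (φ u) (2 * (Λ + 1)), hb, heq, Nat.div_add_mod] }
  refine ⟨fun v => φ v / (2 * (Λ + 1)) * (Λ + 1) + x v,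
    (RunsIn.onClass hx).bind_pure fun v x => φ v / (2 * (Λ + 1)) * (Λ + 1) + x, fun v => ?_,
    fun v u hu heq => ?_⟩
  · have h1 : φ v / (2 * (Λ + 1)) < M := by
      rw [Nat.div_lt_iff_lt_mul hpos]
      have := hφ.lt v
      linarith
    have h2 : (φ v / (2 * (Λ + 1)) + 1) * (Λ + 1) ≤ M * (Λ + 1) := Nat.mul_le_mul_right _ h1
    have h3 := hlegal.lt v
    rw [add_mul] at h2
    omega
  · have hb : φ u / (2 * (Λ + 1)) = φ v / (2 * (Λ + 1)) := by
      have := congrArg (· / (Λ + 1)) heq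
      simpa [Nat.mul_add_div (Nat.succ_pos Λ), mul_comm _ (Λ + 1),
        Nat.div_eq_of_lt (hlegal.lt _)] using this
    refine hlegal.ne v u (Finset.mem_filter.2 ⟨hu, hb⟩) ?_
    simpa [hb] using heq

/-- The number of rounds of the Kuhn–Wattenhofer procedure. -/
def kwTime (Λ m : ℕ) : ℕ := Nat.clog 2 ((m + Λ) / (Λ + 1)) * (Λ + 1)

/-- Padding the palette to `2 ^ t * (Λ + 1)` colors makes every phase halve it exactly. -/
theorem exists_runsIn_kwProc {Λ m : ℕ} (hN : IsNetwork N Λ) {φ : V → ℕ} (hφ : IsLegal N m φ) :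
    ∃ out : V → ℕ, RunsIn N (kwTime Λ m) (fun v => kwProc Λ m (φ v)) out ∧
      IsLegal N (Λ + 1) out := by
  set t := Nat.clog 2 ((m + Λ) / (Λ + 1)) with ht
  have hm : m ≤ 2 ^ t * (Λ + 1) := by
    have h1 : (m + Λ) / (Λ + 1) ≤ 2 ^ t := Nat.le_pow_clog one_lt_two _
    have h2 : m + Λ < ((m + Λ) / (Λ + 1) + 1) * (Λ + 1) :=
      Nat.lt_mul_of_div_lt (Nat.lt_succ_self _) (Nat.succ_pos _)
    have h3 := Nat.mul_le_mul_right (Λ + 1) h1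
    rw [add_mul] at h2
    omega
  obtain ⟨out, hout, h⟩ := RunsIn.loop (N := N) (n := t) (t := Λ + 1)
    (body := fun _ _ x => kwPhase Λ x) (fun s x => IsLegal N (2 ^ (t - s) * (Λ + 1)) x)
    (fun s hs x hx => exists_runsIn_kwPhase hN (by
      rwa [← pow_succ', show t - (s + 1) + 1 = t - s by omega]))
    (s := φ) (hφ.mono hm)
  refine ⟨out, hout, ?_⟩
  rwa [Nat.sub_self, pow_zero, one_mul] at h

end KW

/-! ### Cover-free families from polynomials over a prime field -/

section CoverFree

open Polynomial


/-- The sets are the graphs of distinct polynomials of degree at most `D` over `ZMod q`. Two of them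
share at most `D` points, so `A` others cover at most `A * D < q` points of a graph that has `q` of
them. -/
theorem exists_isCoverFree {A D q m M : ℕ} (hq : q.Prime) (hA : A * D < q)
    (hm : m ≤ q ^ (D + 1)) (hM : q ^ 2 ≤ M) : ∃ T, IsCoverFree A m M T := by
  classical
  have : Fact q.Prime := ⟨hq⟩
  have : NeZero q := ⟨hq.ne_zero⟩
  obtain ⟨e⟩ : Nonempty (Fin m ↪ degreeLT (ZMod q) (D + 1)) := by
    obtain ⟨e⟩ : Nonempty (Fin m ↪ (Fin (D + 1) → ZMod q)) := by
      refine Function.Embedding.nonempty_of_card_le ?_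
      simpa using hm
    exact ⟨e.trans (degreeLTEquiv (ZMod q) (D + 1)).symm.toEquiv.toEmbedding⟩
  let P : ℕ → (ZMod q)[X] := fun x => if h : x < m then (e ⟨x, h⟩ : (ZMod q)[X]) else 0
  have hPdeg : ∀ x, (P x).degree < (D + 1 : ℕ) := by
    intro x
    by_cases h : x < m
    · simp only [P, dif_pos h]
      exact mem_degreeLT.1 (e ⟨x, h⟩).2
    · simp only [P, dif_neg h, degree_zero]
      exact WithBot.bot_lt_coe _
  have hPinj : ∀ x < m, ∀ y < m, P x = P y → x = y := by
    intro x hx y hy hxy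
    simp only [P, dif_pos hx, dif_pos hy] at hxy
    simpa using e.injective (Subtype.ext hxy)
  let code : ℕ → ZMod q → ℕ := fun x a => a.val * q + ((P x).eval a).val
  have hcode : ∀ x y a b, code x a = code y b → a = b ∧ (P x).eval a = (P y).eval b := by
    intro x y a b h
    have h1 : a.val = b.val := by
      have := congrArg (· / q) h
      simpa [code, Nat.mul_add_div hq.pos, mul_comm _ q, Nat.div_eq_of_lt (ZMod.val_lt _)]
        using this
    refine ⟨ZMod.val_injective q h1, ZMod.val_injective q ?_⟩
    simpa [code, h1] using h
  refine ⟨fun x => Finset.univ.image (code x), fun x _ y hy => ?_,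
    fun x hx S hS hcard hxS hsub => ?_⟩
  · obtain ⟨a, -, rfl⟩ := Finset.mem_image.1 hy
    have h1 := Nat.mul_le_mul_right q (ZMod.val_lt a)
    have h2 := ZMod.val_lt ((P x).eval a)
    rw [Finset.mem_range]
    simp only [code]
    rw [Nat.succ_mul] at h1
    nlinarith
  -- If the graph of `P x` were covered, every field element would be a root of some `P x - P y`
  -- with `y ∈ S`.
  · have hroots : (Finset.univ : Finset (ZMod q)) ⊆
        S.biUnion fun y => (P x - P y).roots.toFinset := by
      intro a _
      have ha := hsub (Finset.mem_image_of_mem (code x) (Finset.mem_univ a))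
      obtain ⟨y, hy, hay⟩ := Finset.mem_biUnion.1 ha
      obtain ⟨b, -, hb⟩ := Finset.mem_image.1 hay
      obtain ⟨rfl, heq⟩ := hcode _ _ _ _ hb
      refine Finset.mem_biUnion.2 ⟨y, hy, ?_⟩
      rw [Multiset.mem_toFinset, mem_roots, IsRoot, eval_sub, heq, sub_self]
      rw [sub_ne_zero]
      exact fun h => hxS (hPinj x hx y (Finset.mem_range.1 (hS hy)) h ▸ hy)
    have h1 := Finset.card_le_card hroots
    have h2 : (S.biUnion fun y => (P x - P y).roots.toFinset).card ≤ S.card * D := by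
      refine Finset.card_biUnion_le_card_mul _ _ _ fun y _ => ?_
      refine (Multiset.toFinset_card_le _).trans ((card_roots' _).trans ?_)
      have := (degree_sub_le (P x) (P y)).trans_lt (max_lt (hPdeg x) (hPdeg y))
      exact natDegree_le_iff_coeff_eq_zero.2 fun n hn =>
        coeff_eq_zero_of_degree_lt (this.trans_le (by exact_mod_cast hn))
    rw [Finset.card_univ, ZMod.card] at h1
    have h3 := Nat.mul_le_mul_right D hcard
    omega

/-- Cover-free families of linear size in the square of the parameter, by Bertrand's postulate. -/
theorem exists_isCoverFree_sq {A D m : ℕ} (hA : 1 ≤ A) (hD : 1 ≤ D)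
    (hm : m ≤ (A * D) ^ (D + 1)) : ∃ T, IsCoverFree A m (4 * (A * D) ^ 2) T := by
  obtain ⟨q, hq, h1, h2⟩ := Nat.exists_prime_lt_and_le_two_mul (A * D)
    (Nat.mul_ne_zero (by omega) (by omega))
  refine exists_isCoverFree hq h1 (hm.trans (Nat.pow_le_pow_left h1.le _)) ?_
  calc q ^ 2 ≤ (2 * (A * D)) ^ 2 := Nat.pow_le_pow_left h2 2
    _ = 4 * (A * D) ^ 2 := by ring

theorem coverFreeFamily_spec {A m M : ℕ} (h : ∃ T, IsCoverFree A m M T) :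
    IsCoverFree A m M (coverFreeFamily A m M) := by
  unfold coverFreeFamily
  rw [dif_pos h]
  exact h.choose_spec

variable {V : Type} {N : V → Finset V}

theorem exists_runsIn_coverFreeStep {A m M : ℕ} (hT : ∃ T, IsCoverFree A m M T)
    (hN : IsNetwork N A) {φ : V → ℕ} (hφ : IsLegal N m φ) :
    ∃ out : V → ℕ, RunsIn N 1 (fun v => coverFreeStep A m M (φ v)) out ∧ IsLegal N M out := by
  classical
  have hT := coverFreeFamily_spec hT
  set T := coverFreeFamily A m M with hTdef
  have key : ∀ v, sInf {y : ℕ | y ∈ T (φ v) ∧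
      ∀ x, [x] ∈ ((N v).val.map fun u => [φ u]) → y ∉ T x} ∈ {y : ℕ | y ∈ T (φ v) ∧
      ∀ x, [x] ∈ ((N v).val.map fun u => [φ u]) → y ∉ T x} := by
    intro v
    have h := hT.2 (φ v) (hφ.lt v) ((N v).image φ)
      (fun x hx => by
        obtain ⟨u, -, rfl⟩ := Finset.mem_image.1 hx
        exact Finset.mem_range.2 (hφ.lt u))
      (Finset.card_image_le.trans (hN.card_le v))
      (fun h => by
        obtain ⟨u, hu, he⟩ := Finset.mem_image.1 h
        exact hφ.ne v u hu he)
    obtain ⟨y, hy, hy'⟩ := Finset.not_subset.1 h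
    refine Nat.sInf_mem ⟨y, hy, fun x hx hyx => hy' (Finset.mem_biUnion.2 ⟨x, ?_, hyx⟩)⟩
    simpa using hx
  refine ⟨_, RunsIn.exchange_pure (fun v => [φ v]) (fun v R => sInf {y : ℕ | y ∈ T (φ v) ∧
    ∀ x, [x] ∈ R → y ∉ T x}), fun v => Finset.mem_range.1 (hT.1 _ (hφ.lt v) (key v).1),
    fun v u hu heq => ?_⟩
  refine (key v).2 (φ u) (by simpa using ⟨u, hu, rfl⟩) ?_
  rw [← heq]
  exact (key u).1

end CoverFree

/-! ### Linial's reduction to a maximal independent set -/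

section MIS

variable {V : Type} {N : V → Finset V}

theorem exists_runsIn_misFromColoring {Δ : ℕ} (hN : IsNetwork N Δ) {φ : V → ℕ}
    (hφ : IsLegal N (Δ + 1) φ) :
    ∃ out : V → Bool, RunsIn N (Δ + 1) (fun v => misFromColoring Δ (φ v)) out ∧
      (∀ v, ∀ u ∈ N v, out u = true → out v = false) ∧
      ∀ v, out v = true ∨ ∃ u ∈ N v, out u = true := by
  obtain ⟨out, hout, -, hind, hmax⟩ := RunsIn.loop (N := N) (n := Δ + 1) (t := 1)
    (body := fun v s (b : Bool) => exchange [if b then 1 else 0] >>= fun R =>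
      pure (if φ v = s then decide ([1] ∉ R) else b))
    (fun s b => (∀ v, b v = true → φ v < s) ∧ (∀ v, ∀ u ∈ N v, b u = true → b v = false) ∧
      ∀ v, φ v < s → b v = true ∨ ∃ u ∈ N v, b u = true)
    (by
      rintro s - b ⟨hlt, hind, hmax⟩
      have hmem : ∀ v, [1] ∈ ((N v).val.map fun u => [if b u then 1 else 0]) ↔
          ∃ u ∈ N v, b u = true := by
        intro v
        rw [Multiset.mem_map]
        refine exists_congr fun u => and_congr Iff.rfl ?_
        cases b u <;> simp
      refine ⟨_, RunsIn.exchange_pure (fun v => [if b v then 1 else 0]) (fun v R =>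
        if φ v = s then decide ([1] ∉ R) else b v), ?_, ?_, ?_⟩
      · intro v
        split_ifs with h
        · omega
        · exact fun hb => (hlt v hb).trans (Nat.lt_succ_self s)
      · intro v u hu
        have hsym := hN.symm u v hu
        split_ifs with h1 h2 h2
        · exact absurd (h1.trans h2.symm) (hφ.ne v u hu)
        · rw [decide_eq_true_iff, hmem]
          intro h
          by_contra hb
          exact h ⟨v, hsym, by simpa using hb⟩
        · intro hb
          rw [decide_eq_false_iff_not, not_not, hmem]
          exact ⟨u, hu, hb⟩
        · exact hind v u hu
      · intro v hv
        have hmono : ∀ u ∈ N v, b u = true → (if φ u = s then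
            decide ([1] ∉ ((N u).val.map fun u => [if b u then 1 else 0])) else b u) = true := by
          intro u _ hb
          rw [if_neg (hlt u hb).ne]
          exact hb
        by_cases h : φ v = s
        · by_cases hn : ∃ u ∈ N v, b u = true
          · obtain ⟨u, hu, hb⟩ := hn
            exact Or.inr ⟨u, hu, hmono u hu hb⟩
          · left
            rw [if_pos h, decide_eq_true_iff, hmem]
            exact hn
        · rw [if_neg h]
          rcases hmax v (by omega) with hb | ⟨u, hu, hb⟩
          · exact Or.inl hb
          · exact Or.inr ⟨u, hu, hmono u hu hb⟩)
    (s := fun _ => false)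
    ⟨fun _ h => absurd h (by simp), fun _ _ _ _ => rfl, fun v hv => absurd hv (by omega)⟩
  rw [mul_one] at hout
  exact ⟨out, hout, hind, fun v => hmax v (hφ.lt v)⟩

end MIS

/-! ### Correctness of Delta-Color -/

/-- The number of rounds of Procedure Delta-Color. -/
noncomputable def deltaTime (c : ℕ) (ε : ℝ) : ℕ → ℕ → ℕ
  | 0, Λ => kwTime Λ (c * Λ ^ 2)
  | 1, Λ => kwTime Λ (c * Λ ^ 2)
  | i + 2, Λ =>
    let k := ⌊iterLog (i + 1) (Λ : ℝ)⌋₊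
    let q := ⌊(Λ : ℝ) ^ ε⌋₊
    if 1 ≤ k ∧ k ^ 2 < q then
      let t := numIterations k q (c * Λ ^ 2)
      let d := t * (Λ / k)
      t * (2 * q) + (1 + deltaTime c ε (i + 1) d + kwTime Λ (k ^ 2 * (d + 1)))
    else kwTime Λ (c * Λ ^ 2)

/-- At least two iterations are needed to get from `c * Λ ^ 2` colors to `k ^ 2` colors. -/
theorem two_le_numIterations {c Λ k q : ℕ} (hc : 2 ≤ c) (hk : 1 ≤ k) (hkq : k ^ 2 < q)
    (hq : q ≤ Λ) : 2 ≤ numIterations k q (c * Λ ^ 2) := by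
  have hmem := iterate_numIterations_le hkq (c * Λ ^ 2)
  have hΛ : 1 ≤ Λ := by omega
  have hk2 : 0 < k ^ 2 := by positivity
  by_contra! hlt
  have h0 : k ^ 2 < c * Λ ^ 2 := by nlinarith
  -- The first iteration works with at least two classes, so it leaves at least `2 * k ^ 2` colors.
  have h1 : k ^ 2 < nextPalette k q (c * Λ ^ 2) := by
    have : 2 ≤ c * Λ ^ 2 / q := by
      rw [Nat.le_div_iff_mul_le (by omega)]
      nlinarith
    calc k ^ 2 < 2 * k ^ 2 := by omega
      _ ≤ _ := Nat.mul_le_mul_right _ (this.trans (le_max_left _ _))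
  generalize numIterations k q (c * Λ ^ 2) = t at hmem hlt
  interval_cases t
  · exact absurd hmem h0.not_ge
  · exact absurd hmem h1.not_ge

theorem le_two_mul_div_mul {Λ k : ℕ} (hk : 1 ≤ k) (hkΛ : k ≤ Λ) : Λ ≤ 2 * (Λ / k) * k := by
  have h1 : 1 ≤ Λ / k := (Nat.one_le_div_iff hk).2 hkΛ
  have h2 : Λ < (Λ / k + 1) * k := Nat.lt_mul_of_div_lt (Nat.lt_succ_self _) hk
  have h3 := Nat.mul_le_mul_right k h1
  rw [add_mul] at h2
  linarith

/-- The floor in `Λ / k` loses at most a factor 2, and the second iteration makes up for it. -/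
theorem le_defect_mul {c Λ k q : ℕ} (hc : 2 ≤ c) (hk : 1 ≤ k) (hkq : k ^ 2 < q)
    (hq : q ≤ Λ) : Λ ≤ numIterations k q (c * Λ ^ 2) * (Λ / k) * k := by
  have hkΛ : k ≤ Λ := (Nat.le_self_pow two_ne_zero k).trans (by omega)
  refine (le_two_mul_div_mul hk hkΛ).trans ?_
  gcongr
  exact two_le_numIterations hc hk hkq hq

theorem floor_rpow_le {ε : ℝ} (hε0 : 0 < ε) (hε : ε < 1) (Λ : ℕ) : ⌊(Λ : ℝ) ^ ε⌋₊ ≤ Λ := by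
  rcases Nat.eq_zero_or_pos Λ with rfl | hΛ
  · rw [Nat.cast_zero, Real.zero_rpow hε0.ne', Nat.floor_zero]
  · refine Nat.floor_le_of_le ?_
    calc (Λ : ℝ) ^ ε ≤ (Λ : ℝ) ^ (1 : ℝ) :=
          Real.rpow_le_rpow_of_exponent_le (by exact_mod_cast hΛ) hε.le
      _ = Λ := Real.rpow_one _

theorem exists_runsIn_deltaColor {V : Type} {ε : ℝ} (hε0 : 0 < ε) (hε : ε < 1) (i : ℕ) :
    ∀ {N : V → Finset V} {Λ : ℕ} {φ : V → ℕ}, IsNetwork N Λ → IsLegal N (64 * Λ ^ 2) φ →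
    ∃ out : V → ℕ, RunsIn N (deltaTime 64 ε i Λ) (fun v => deltaColor 64 ε i Λ (φ v)) out ∧
      IsLegal N (Λ + 1) out := by
  induction i using Nat.twoStepInduction with
  | zero => exact fun hN hφ => exists_runsIn_kwProc hN hφ
  | one => exact fun hN hφ => exists_runsIn_kwProc hN hφ
  | more i _ ih =>
    intro N Λ φ hN hφ
    simp only [deltaColor, deltaTime]
    set k := ⌊iterLog (i + 1) (Λ : ℝ)⌋₊
    set q := ⌊(Λ : ℝ) ^ ε⌋₊ with hq
    split_ifs with hkq
    swap
    · exact exists_runsIn_kwProc hN hφ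
    obtain ⟨hk, hkq⟩ := hkq
    have hqΛ : q ≤ Λ := floor_rpow_le hε0 hε Λ
    have hd := le_defect_mul (c := 64) (by norm_num) hk hkq hqΛ
    set d := numIterations k q (64 * Λ ^ 2) * (Λ / k)
    obtain ⟨j, hj, hjlt, hjdef⟩ := exists_runsIn_defectiveColor hk hkq hN.card_le hφ
    have hNj : IsNetwork (fun v => (N v).filter fun u => j u = j v) d :=
      ⟨(hN.filter j).symm, hjdef⟩
    -- Degree `D = 4` suffices: from `Λ ≤ d ^ 2` one gets `64 * Λ ^ 2 ≤ 64 * d ^ 4 ≤ (4 * d) ^ 5`,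
    -- and the ground set has `4 * (4 * d) ^ 2 = 64 * d ^ 2` elements.
    have hT : ∃ T, IsCoverFree d (64 * Λ ^ 2) (64 * d ^ 2) T := by
      have hd1 : 1 ≤ d := by
        by_contra! h
        have : d = 0 := by omega
        rw [this] at hd
        omega
      have hΛd : Λ ≤ d ^ 2 := by
        have h1 : Λ ^ 2 ≤ d ^ 2 * Λ := by
          calc Λ ^ 2 ≤ (d * k) ^ 2 := Nat.pow_le_pow_left hd 2
            _ = d ^ 2 * k ^ 2 := by ring
            _ ≤ d ^ 2 * Λ := Nat.mul_le_mul_left _ (by omega)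
        rw [sq Λ] at h1
        exact Nat.le_of_mul_le_mul_right h1 (by omega)
      have := exists_isCoverFree_sq (m := 64 * Λ ^ 2) hd1 (show 1 ≤ 4 by norm_num) (by
        calc 64 * Λ ^ 2 ≤ 64 * (d ^ 2) ^ 2 := by gcongr
          _ = 64 * d ^ 4 * 1 := by ring
          _ ≤ 64 * d ^ 4 * (16 * d) := by gcongr; omega
          _ = (d * 4) ^ (4 + 1) := by ring)
      rwa [show 4 * (d * 4) ^ 2 = 64 * d ^ 2 by ring] at this
    obtain ⟨φ', hφ', hlegal'⟩ := exists_runsIn_coverFreeStep hT hNj (hφ.filter j)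
    obtain ⟨x, hx, hxlegal⟩ := ih hNj hlegal'
    have hlegal : IsLegal N (k ^ 2 * (d + 1)) fun v => x v + (d + 1) * j v := by
      refine ⟨fun v => ?_, fun v u hu heq => ?_⟩
      · have h1 := hxlegal.lt v
        have h2 := Nat.mul_le_mul_right (d + 1) (hjlt v)
        rw [Nat.succ_mul, mul_comm (j v)] at h2
        omega
      · have hju : j u = j v := by
          have := congrArg (· / (d + 1)) heq
          simpa [Nat.add_mul_div_left _ _ (Nat.succ_pos d), Nat.div_eq_of_lt (hxlegal.lt _)]
            using this
        refine hxlegal.ne v u (Finset.mem_filter.2 ⟨hu, hju⟩) ?_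
        simpa [hju] using heq
    obtain ⟨out, hout, hlegal_out⟩ := exists_runsIn_kwProc hN hlegal
    refine ⟨out, ?_, hlegal_out⟩
    have h1 := RunsIn.onClass (hφ'.bind (f := fun _ y => deltaColor 64 ε (i + 1) d y) hx)
    exact hj.bind (f := fun v j => onClass j (do
        let φ ← coverFreeStep d (64 * Λ ^ 2) (64 * d ^ 2) (φ v)
        deltaColor 64 ε (i + 1) d φ) >>= fun x => kwProc Λ (k ^ 2 * (d + 1)) (x + (d + 1) * j))
      (h1.bind (f := fun v x => kwProc Λ (k ^ 2 * (d + 1)) (x + (d + 1) * j v)) hout)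

/-! ### Iterated exponentials and logarithms -/

open Real Filter

section ExpTower

/-- The iterated exponential to base `2`. -/
noncomputable def expTower (j : ℕ) (y : ℝ) : ℝ := (fun x : ℝ => (2 : ℝ) ^ x)^[j] y

variable {j : ℕ} {x y : ℝ}

theorem expTower_zero (y : ℝ) : expTower 0 y = y := rfl

theorem expTower_succ (j : ℕ) (y : ℝ) : expTower (j + 1) y = expTower j (2 ^ y) :=
  Function.iterate_succ_apply _ _ _

theorem expTower_succ' (j : ℕ) (y : ℝ) : expTower (j + 1) y = 2 ^ expTower j y :=
  Function.iterate_succ_apply' _ _ _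

theorem iterLog_succ (j : ℕ) (x : ℝ) : iterLog (j + 1) x = iterLog j (logb 2 x) :=
  Function.iterate_succ_apply _ _ _

theorem iterLog_succ' (j : ℕ) (x : ℝ) : iterLog (j + 1) x = logb 2 (iterLog j x) :=
  Function.iterate_succ_apply' _ _ _

theorem iterLog_expTower (j : ℕ) (y : ℝ) : iterLog j (expTower j y) = y := by
  induction j with
  | zero => rfl
  | succ j ih =>
    rw [expTower_succ', iterLog_succ, logb_rpow (by norm_num) (by norm_num), ih]

theorem expTower_strictMono (j : ℕ) : StrictMono (expTower j) :=
  StrictMono.iterate (fun _ _ h => rpow_lt_rpow_of_exponent_lt (by norm_num) h) j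

theorem add_one_le_two_rpow {x : ℝ} (hx : 1 ≤ x) : x + 1 ≤ 2 ^ x := by
  have := one_add_mul_self_le_rpow_one_add (s := 1) (by norm_num) hx
  norm_num at this
  linarith

theorem add_le_expTower (j : ℕ) {y : ℝ} (hy : 1 ≤ y) : y + j ≤ expTower j y := by
  induction j with
  | zero => simp [expTower_zero]
  | succ j ih =>
    rw [expTower_succ', Nat.cast_succ]
    have := add_one_le_two_rpow (x := expTower j y) (by
      have : (0 : ℝ) ≤ j := Nat.cast_nonneg j
      linarith)
    linarith

theorem le_expTower (j : ℕ) {y : ℝ} (hy : 1 ≤ y) : y ≤ expTower j y :=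
  (le_add_of_nonneg_right (Nat.cast_nonneg j)).trans (add_le_expTower j hy)

theorem expTower_iterLog_of_le (h : expTower j y ≤ x) :
    expTower j (iterLog j x) = x ∧ y ≤ iterLog j x := by
  induction j generalizing x with
  | zero => exact ⟨rfl, h⟩
  | succ j ih =>
    rw [expTower_succ'] at h
    have hx : 0 < x := (rpow_pos_of_pos two_pos _).trans_le h
    obtain ⟨h1, h2⟩ := ih (x := logb 2 x) ((le_logb_iff_rpow_le one_lt_two hx).2 h)
    rw [iterLog_succ, expTower_succ', h1]
    exact ⟨rpow_logb two_pos (by norm_num) hx, h2⟩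

/-- Positivity keeps the logarithms away from the arguments at which `logb` has default values. -/
theorem expTower_iterLog_of_pos (h : ∀ i < j, 0 < iterLog i x) :
    expTower j (iterLog j x) = x := by
  induction j with
  | zero => rfl
  | succ j ih =>
    rw [iterLog_succ', expTower_succ, rpow_logb two_pos (by norm_num) (h j (Nat.lt_succ_self j))]
    exact ih fun i hi => h i (hi.trans (Nat.lt_succ_self j))

theorem two_rpow_mul_expTower_le_of_add_le {δ : ℝ} (h : expTower j y + δ ≤ expTower j (y + δ)) :
    2 ^ δ * expTower (j + 1) y ≤ expTower (j + 1) (y + δ) := by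
  rw [expTower_succ', expTower_succ', mul_comm, ← rpow_add two_pos]
  exact rpow_le_rpow_of_exponent_le one_le_two h

theorem expTower_add_le (j : ℕ) {δ : ℝ} (hy : 1 ≤ y) (hδ : 0 ≤ δ) :
    expTower j y + δ ≤ expTower j (y + δ) := by
  induction j with
  | zero => exact le_rfl
  | succ j ih =>
    refine le_trans ?_ (two_rpow_mul_expTower_le_of_add_le ih)
    have h1 : (2 : ℝ) ≤ expTower (j + 1) y := by
      have := add_le_expTower (j + 1) hy
      push_cast at this
      have : (0 : ℝ) ≤ j := Nat.cast_nonneg j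
      linarith
    have h2 : 1 + δ / 2 ≤ (2 : ℝ) ^ δ := by
      rw [rpow_def_of_pos two_pos]
      have h3 := add_one_le_exp (log 2 * δ)
      have h4 := log_two_gt_d9
      nlinarith
    nlinarith

/-- Multiplying a tower by a constant moves its top by no more than the logarithm of that constant.
The recursion uses this to compare the iterated logarithms of `Λ` and `d`. -/
theorem two_rpow_mul_expTower_le (j : ℕ) {δ : ℝ} (hy : 1 ≤ y) (hδ : 0 ≤ δ) :
    2 ^ δ * expTower (j + 1) y ≤ expTower (j + 1) (y + δ) :=
  two_rpow_mul_expTower_le_of_add_le (expTower_add_le j hy hδ)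

theorem exists_iterLog_le_two (x : ℝ) : ∃ i, iterLog i x ≤ 2 := by
  by_contra! h
  obtain ⟨j, hj⟩ := exists_nat_ge x
  -- If all iterated logarithms exceeded 2, then `x` would be a tower of every height `j` over a top
  -- above 2, hence larger than `j`.
  have h1 := expTower_iterLog_of_pos (j := j) fun i _ => two_pos.trans (h i)
  have h2 := add_le_expTower j (y := iterLog j x) (by linarith [h j])
  linarith [h j]

theorem iterLog_logStar_le (n : ℕ) : iterLog (logStar n) n ≤ 2 :=
  Nat.sInf_mem (s := {i : ℕ | iterLog i (n : ℝ) ≤ 2}) (exists_iterLog_le_two n)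

theorem two_lt_iterLog {n i : ℕ} (h : i < logStar n) : 2 < iterLog i n :=
  not_le.1 (Nat.notMem_of_lt_sInf (s := {i : ℕ | iterLog i (n : ℝ) ≤ 2}) h)

theorem expTower_iterLog_logStar {n i : ℕ} (h : i ≤ logStar n) :
    expTower i (iterLog i n) = n :=
  expTower_iterLog_of_pos fun _ hj => two_pos.trans (two_lt_iterLog (hj.trans_le h))

theorem le_expTower_logStar (n : ℕ) : (n : ℝ) ≤ expTower (logStar n) 2 := by
  conv_lhs => rw [← expTower_iterLog_logStar (n := n) le_rfl]
  exact (expTower_strictMono _).monotone (iterLog_logStar_le n)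

end ExpTower

/-! ### Bounds for the number of iterations and for the Kuhn–Wattenhofer time -/

section Asymptotics

/-- Logarithms are `o(Λ ^ (ε / 4))`, and the floor costs at most a factor 2. For `k ≤ log Λ` this
makes `k ^ 2 / q`, the shrinking factor of an iteration, at most `Λ ^ (-ε / 2)`. -/
theorem exists_sq_logb_le {ε : ℝ} (hε : 0 < ε) : ∃ Λ₀ : ℕ, 2 ≤ Λ₀ ∧ ∀ Λ : ℕ, Λ₀ ≤ Λ →
    logb 2 Λ ^ 2 ≤ (Λ : ℝ) ^ (-(ε / 2)) * ⌊(Λ : ℝ) ^ ε⌋₊ := by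
  have h1 := (isLittleO_log_rpow_atTop (show 0 < ε / 4 by positivity)).bound
    (show (0 : ℝ) < 1 / 4 by norm_num)
  have h2 := (tendsto_rpow_atTop hε).eventually_ge_atTop 2
  obtain ⟨Λ₀, hΛ₀⟩ :=
    ((tendsto_natCast_atTop_atTop (R := ℝ)).eventually (h1.and h2)).exists_forall_of_atTop
  refine ⟨max Λ₀ 2, le_max_right _ _, fun Λ hΛ => ?_⟩
  obtain ⟨h3, h4⟩ := hΛ₀ Λ ((le_max_left _ _).trans hΛ)
  have hΛ2 : (2 : ℝ) ≤ Λ := by exact_mod_cast (le_max_right Λ₀ 2).trans hΛ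
  have hpos : (0 : ℝ) < Λ := by linarith
  have hlog : 0 ≤ log Λ := log_nonneg (by linarith)
  rw [norm_of_nonneg hlog, norm_of_nonneg (rpow_nonneg hpos.le _)] at h3
  have h5 : logb 2 Λ ≤ 1 / 2 * (Λ : ℝ) ^ (ε / 4) := by
    rw [logb, div_le_iff₀ (log_pos one_lt_two)]
    have := log_two_gt_d9
    have := rpow_nonneg hpos.le (ε / 4)
    nlinarith
  have h6 : (Λ : ℝ) ^ ε / 2 ≤ ⌊(Λ : ℝ) ^ ε⌋₊ := by
    have := Nat.lt_floor_add_one ((Λ : ℝ) ^ ε)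
    linarith
  calc logb 2 Λ ^ 2 ≤ (1 / 2 * (Λ : ℝ) ^ (ε / 4)) ^ 2 :=
        pow_le_pow_left₀ (logb_nonneg one_lt_two (by linarith)) h5 2
    _ = 1 / 4 * (Λ : ℝ) ^ (ε / 2) := by
        rw [mul_pow, ← rpow_natCast ((Λ : ℝ) ^ (ε / 4)), ← rpow_mul hpos.le]
        norm_num
        congr 1
        ring
    _ ≤ (Λ : ℝ) ^ (-(ε / 2)) * ((Λ : ℝ) ^ ε / 2) := by
        rw [mul_div_assoc', ← rpow_add hpos, show -(ε / 2) + ε = ε / 2 by ring]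
        have := rpow_nonneg hpos.le (ε / 2)
        linarith
    _ ≤ _ := mul_le_mul_of_nonneg_left h6 (rpow_nonneg hpos.le _)

theorem iterate_nextPalette_le {p q χ : ℕ} {r : ℝ} (hpq : p ^ 2 < q) (hr0 : 0 ≤ r)
    (hr : ((p ^ 2 : ℕ) : ℝ) ≤ r * q) (s : ℕ) :
    (((nextPalette p q)^[s] χ : ℕ) : ℝ) ≤ max (χ * r ^ s) ((p ^ 2 : ℕ) : ℝ) := by
  induction s with
  | zero => simp
  | succ s ih =>
    rw [Function.iterate_succ_apply']
    generalize (nextPalette p q)^[s] χ = χs at ih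
    have hsmall : χs / q ≤ 1 → ((nextPalette p q χs : ℕ) : ℝ) ≤ ((p ^ 2 : ℕ) : ℝ) := by
      intro h
      rw [nextPalette, max_eq_right h, one_mul]
    rcases le_total (χs / q) 1 with h | h
    · exact (hsmall h).trans (le_max_right _ _)
    rcases le_max_iff.1 ih with h' | h'
    · refine le_trans ?_ (le_max_left _ _)
      rw [nextPalette, max_eq_left h, Nat.cast_mul]
      have h1 : ((χs / q : ℕ) : ℝ) * q ≤ χs := by exact_mod_cast Nat.div_mul_le_self _ _
      calc ((χs / q : ℕ) : ℝ) * ((p ^ 2 : ℕ) : ℝ) ≤ ((χs / q : ℕ) : ℝ) * (r * q) := by gcongr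
        _ = r * (((χs / q : ℕ) : ℝ) * q) := by ring
        _ ≤ r * (χ * r ^ s) := mul_le_mul_of_nonneg_left (h1.trans h') hr0
        _ = χ * r ^ (s + 1) := by ring
    · have h2 : χs / q = 0 := Nat.div_eq_of_lt ((Nat.cast_le.1 h').trans_lt hpq)
      exact (hsmall (by omega)).trans (le_max_right _ _)

/-- For large `Λ` the initial palette is at most `Λ ^ 3`, which `6 / ε` iterations with factor `Λ ^
(-ε / 2)` exhaust. For the finitely many other `Λ` the trivial bound by the palette size is enough.
-/
theorem exists_numIterations_le {ε : ℝ} (hε : 0 < ε) (c : ℕ) : ∃ B : ℕ, 2 ≤ B ∧ ∀ Λ k : ℕ,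
    1 ≤ k → k ^ 2 < ⌊(Λ : ℝ) ^ ε⌋₊ → (k : ℝ) ≤ logb 2 Λ →
    numIterations k ⌊(Λ : ℝ) ^ ε⌋₊ (c * Λ ^ 2) ≤ B := by
  obtain ⟨Λ₀, hΛ₀2, hΛ₀⟩ := exists_sq_logb_le hε
  refine ⟨c * (max Λ₀ c) ^ 2 + ⌈6 / ε⌉₊ + 2, by omega, fun Λ k hk hkq hkΛ => ?_⟩
  rcases le_total Λ (max Λ₀ c) with hΛ | hΛ
  · have h1 := numIterations_le hkq (c * Λ ^ 2)
    have h2 : c * Λ ^ 2 ≤ c * (max Λ₀ c) ^ 2 := by gcongr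
    omega
  · have h1 := hΛ₀ Λ ((le_max_left _ _).trans hΛ)
    have hcΛ : (c : ℝ) ≤ Λ := by exact_mod_cast (le_max_right _ _).trans hΛ
    have hΛ1 : (1 : ℝ) ≤ Λ := by
      have := (le_max_left Λ₀ c).trans hΛ
      exact_mod_cast (by omega : 1 ≤ Λ)
    have hpos : (0 : ℝ) < Λ := by linarith
    set q := ⌊(Λ : ℝ) ^ ε⌋₊
    have hr : ((k ^ 2 : ℕ) : ℝ) ≤ (Λ : ℝ) ^ (-(ε / 2)) * q := by
      refine le_trans ?_ h1
      rw [Nat.cast_pow]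
      exact pow_le_pow_left₀ (Nat.cast_nonneg k) hkΛ 2
    have h2 := iterate_nextPalette_le (χ := c * Λ ^ 2) hkq (rpow_nonneg hpos.le _) hr ⌈6 / ε⌉₊
    have h3 : ((c * Λ ^ 2 : ℕ) : ℝ) * ((Λ : ℝ) ^ (-(ε / 2))) ^ ⌈6 / ε⌉₊ ≤ 1 := by
      have h4 : ((Λ : ℝ) ^ (-(ε / 2))) ^ ⌈6 / ε⌉₊ ≤ (Λ : ℝ) ^ (-3 : ℝ) := by
        rw [← rpow_natCast, ← rpow_mul hpos.le]
        refine rpow_le_rpow_of_exponent_le hΛ1 ?_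
        have h5 : 6 / ε ≤ ⌈6 / ε⌉₊ := Nat.le_ceil _
        rw [div_le_iff₀ hε] at h5
        linarith
      calc ((c * Λ ^ 2 : ℕ) : ℝ) * ((Λ : ℝ) ^ (-(ε / 2))) ^ ⌈6 / ε⌉₊
          ≤ (Λ * Λ ^ 2) * (Λ : ℝ) ^ (-3 : ℝ) := by
            push_cast
            gcongr
        _ = 1 := by
            rw [show (Λ : ℝ) * Λ ^ 2 = (Λ : ℝ) ^ (3 : ℝ) by
              rw [show (3 : ℝ) = (3 : ℕ) by norm_num, rpow_natCast]; ring, ← rpow_add hpos]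
            norm_num
    have h4 : (nextPalette k q)^[⌈6 / ε⌉₊] (c * Λ ^ 2) ≤ k ^ 2 := by
      have h5 : (1 : ℝ) ≤ ((k ^ 2 : ℕ) : ℝ) := by exact_mod_cast Nat.one_le_pow _ _ hk
      exact_mod_cast h2.trans (max_le (h3.trans h5) le_rfl)
    have h5 : numIterations k q (c * Λ ^ 2) ≤ ⌈6 / ε⌉₊ :=
      Nat.sInf_le (s := {t : ℕ | (nextPalette k q)^[t] (c * Λ ^ 2) ≤ k ^ 2}) h4
    omega

theorem clog_le_logb_add_one {n : ℕ} {x : ℝ} (hx : 1 ≤ x) (hn : (n : ℝ) ≤ x) :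
    (Nat.clog 2 n : ℝ) ≤ logb 2 x + 1 := by
  have h0 : 0 ≤ logb 2 x := logb_nonneg one_lt_two hx
  rcases Nat.eq_zero_or_pos n with rfl | hpos
  · simp only [Nat.clog_zero_right, Nat.cast_zero]; linarith
  · have h1 : (1 : ℝ) ≤ n := by exact_mod_cast hpos
    have h2 : logb 2 n ≤ logb 2 x := logb_le_logb_of_le one_lt_two (by linarith) hn
    have h3 := Nat.ceil_lt_add_one (logb_nonneg one_lt_two h1)
    have h4 : ⌈logb (2 : ℕ) n⌉₊ = Nat.clog 2 n := Real.natCeil_logb_natCast 2 n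
    rw [Nat.cast_ofNat] at h4
    rw [h4] at h3
    linarith

theorem kwTime_le {Λ m : ℕ} {x : ℝ} (hΛ : 1 ≤ Λ) (hx : 1 ≤ x)
    (hm : (m : ℝ) ≤ x * (Λ + 1) - Λ) : (kwTime Λ m : ℝ) ≤ 2 * Λ * (logb 2 x + 1) := by
  have h1 : (((m + Λ) / (Λ + 1) : ℕ) : ℝ) ≤ x := by
    refine Nat.cast_div_le.trans ?_
    push_cast
    rw [div_le_iff₀ (by positivity)]
    linarith
  have h2 := clog_le_logb_add_one hx h1
  have h3 : (1 : ℝ) ≤ Λ := by exact_mod_cast hΛ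
  have h0 : 0 ≤ logb 2 x := logb_nonneg one_lt_two hx
  unfold kwTime
  push_cast
  calc _ ≤ (logb 2 x + 1) * (Λ + 1) := by gcongr
    _ ≤ (logb 2 x + 1) * (2 * Λ) := by gcongr; linarith
    _ = _ := by ring

theorem kwTime_mul_sq_le {c Λ : ℕ} {x : ℝ} (hc : 1 ≤ c) (hΛ : 1 ≤ Λ) (hx : (c * Λ : ℝ) ≤ x) :
    (kwTime Λ (c * Λ ^ 2) : ℝ) ≤ 2 * Λ * (logb 2 x + 1) := by
  have h1 : (1 : ℝ) ≤ c := by exact_mod_cast hc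
  have h2 : (1 : ℝ) ≤ Λ := by exact_mod_cast hΛ
  refine kwTime_le hΛ (by nlinarith) ?_
  push_cast
  nlinarith

end Asymptotics

/-! ### The running time of Delta-Color is linear -/

section DeltaTime

/-- The weight of the levels of the recursion whose parameter `k` is small. -/
noncomputable def levelWeight (B : ℕ) (y : ℝ) : ℝ := 1 + (8 * B : ℝ) ^ (8 * B + 1 - y)

theorem one_le_levelWeight (B : ℕ) (y : ℝ) : 1 ≤ levelWeight B y :=
  le_add_of_nonneg_right (rpow_nonneg (by positivity) _)

theorem levelWeight_antitone {B : ℕ} (hB : 1 ≤ B) : Antitone (levelWeight B) := by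
  intro x y hxy
  have : (1 : ℝ) ≤ B := by exact_mod_cast hB
  exact add_le_add_right (rpow_le_rpow_of_exponent_le (by linarith) (by linarith)) 1

/-- For `y ≥ 8 * B` the factor `2 * B / y` is at most `1 / 4`. Below that it is at most `B`, while
the weight's exponential part drops by the factor `8 * B` from `y` to `y + 1`. The spare `1 / 2`
pays for the cost of the level itself. -/
theorem mul_levelWeight_add_one_le {B : ℕ} (hB : 1 ≤ B) {y : ℝ} (hy : 2 ≤ y) :
    2 * B / y * levelWeight B (y + 1) + 1 / 2 ≤ levelWeight B y := by
  have hB1 : (1 : ℝ) ≤ B := by exact_mod_cast hB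
  have hD : (0 : ℝ) < 8 * B := by positivity
  unfold levelWeight
  set w := (8 * B : ℝ) ^ (8 * B + 1 - (y + 1)) with hw
  have hw0 : 0 ≤ w := rpow_nonneg hD.le _
  have hstep : (8 * B : ℝ) ^ (8 * B + 1 - y) = 8 * B * w := by
    rw [hw, mul_comm _ ((8 * B : ℝ) ^ (8 * B + 1 - (y + 1))), ← rpow_add_one hD.ne']
    congr 1
    ring
  rw [hstep]
  rcases le_total (8 * B : ℝ) y with h | h
  · have h1 : 2 * B / y ≤ 1 / 4 := by rw [div_le_iff₀ (by linarith)]; linarith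
    nlinarith
  · have h1 : 2 * B / y ≤ B := by rw [div_le_iff₀ (by linarith)]; nlinarith
    have h2 : 1 ≤ w := by
      rw [hw]
      exact one_le_rpow (by linarith) (by linarith)
    nlinarith

theorem deltaTime_add_two (c : ℕ) (ε : ℝ) (i Λ : ℕ) : deltaTime c ε (i + 2) Λ =
    let k := ⌊iterLog (i + 1) (Λ : ℝ)⌋₊
    let q := ⌊(Λ : ℝ) ^ ε⌋₊
    if 1 ≤ k ∧ k ^ 2 < q then
      let t := numIterations k q (c * Λ ^ 2)
      let d := t * (Λ / k)
      t * (2 * q) + (1 + deltaTime c ε (i + 1) d + kwTime Λ (k ^ 2 * (d + 1)))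
    else kwTime Λ (c * Λ ^ 2) :=
  rfl

/-- The cost of one level of the recursion, apart from the recursive call. -/
theorem level_cost_le {Λ k q t B : ℕ} {y : ℝ} (hk : 1 ≤ k) (hkq : k ^ 2 < q) (hq : q ≤ Λ)
    (ht : t ≤ B) (hky : (k : ℝ) ≤ y) :
    ((t * (2 * q) + 1 + kwTime Λ (k ^ 2 * (t * (Λ / k) + 1)) : ℕ) : ℝ) ≤
      Λ * (2 * logb 2 y + (2 * B + 3 + 2 * logb 2 (B + 2))) := by
  have hkΛ : k ≤ Λ := (Nat.le_self_pow two_ne_zero k).trans (by omega)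
  have hΛ : 1 ≤ Λ := hk.trans hkΛ
  have hk1 : (1 : ℝ) ≤ k := by exact_mod_cast hk
  have hB0 : (0 : ℝ) ≤ B := Nat.cast_nonneg B
  have hΛ1 : (1 : ℝ) ≤ Λ := by exact_mod_cast hΛ
  have hkΛ' : (k : ℝ) ≤ Λ := by exact_mod_cast hkΛ
  have h1 : ((t * (2 * q) : ℕ) : ℝ) ≤ 2 * B * Λ := by
    have h : t * (2 * q) ≤ 2 * B * Λ := by
      calc t * (2 * q) ≤ B * (2 * Λ) := by gcongr
        _ = _ := by ring
    exact_mod_cast h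
  -- One factor `k` cancels against `Λ / k`, so merging the classes takes only about `log k` phases.
  have h2 : (k ^ 2 * (t * (Λ / k) + 1) : ℕ) ≤ k * B * Λ + k * Λ := by
    have h : k * (Λ / k) ≤ Λ := Nat.mul_div_le _ _
    calc k ^ 2 * (t * (Λ / k) + 1) = k * t * (k * (Λ / k)) + k * k := by ring
      _ ≤ _ := by gcongr
  have h3 : (kwTime Λ (k ^ 2 * (t * (Λ / k) + 1)) : ℝ) ≤
      2 * Λ * (logb 2 (k * (B + 2)) + 1) := by
    refine kwTime_le hΛ (by nlinarith) ?_
    have h : ((k ^ 2 * (t * (Λ / k) + 1) : ℕ) : ℝ) ≤ k * B * Λ + k * Λ := by exact_mod_cast h2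
    refine h.trans ?_
    have : 0 ≤ (k : ℝ) * B := by positivity
    nlinarith
  rw [logb_mul (by linarith) (by linarith)] at h3
  have h4 : logb 2 k ≤ logb 2 y := logb_le_logb_of_le one_lt_two (by linarith) hky
  rw [Nat.cast_add, Nat.cast_add, Nat.cast_one]
  nlinarith

/-- Lower bound: `2 ^ y ≥ y + 1 + log y`, and a shift by `log y` outweighs the division of `Λ` by `k
≤ y`. Upper bound: a factor `b` raises the top of the tower for `Λ` by at most `log b`, and that
tower is one level higher than the tower for `d`. -/
theorem exists_expTower_eq_of_recursion {i Λ d k : ℕ} {y b : ℝ} (hy : 2 ≤ y)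
    (hΛ : (Λ : ℝ) = expTower (i + 2) y) (hb : 1 ≤ b) (hky : (k : ℝ) ≤ y)
    (hΛd : (Λ : ℝ) ≤ d * k) (hdΛ : (d : ℝ) ≤ b * Λ) :
    ∃ y', (d : ℝ) = expTower (i + 1) y' ∧ y + 1 ≤ y' ∧ logb 2 y' ≤ y + logb 2 b := by
  have hlogy : 0 ≤ logb 2 y := logb_nonneg one_lt_two (by linarith)
  have hlogb : 0 ≤ logb 2 b := logb_nonneg one_lt_two hb
  have hlow : expTower (i + 1) (y + 1) ≤ d := by
    have h1 : y + 1 + logb 2 y ≤ 2 ^ y := by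
      have h2 := one_add_mul_self_le_rpow_one_add (s := 1) (by norm_num)
        (show 1 ≤ y - 1 by linarith)
      have h3 : (2 : ℝ) ^ y = 2 * 2 ^ (y - 1) := by
        rw [← rpow_one_add' two_pos.le (by linarith)]; congr 1; ring
      have h4 : y ≤ (2 : ℝ) ^ (y - 1) := by norm_num at h2; linarith
      have h5 : logb 2 y ≤ y - 1 := (logb_le_iff_le_rpow one_lt_two (by linarith)).2 h4
      linarith
    have h2 := two_rpow_mul_expTower_le i (show 1 ≤ y + 1 by linarith) hlogy
    rw [rpow_logb two_pos (by norm_num) (by linarith)] at h2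
    have h3 : y * expTower (i + 1) (y + 1) ≤ y * d := by
      calc _ ≤ _ := h2
        _ ≤ expTower (i + 1) (2 ^ y) := (expTower_strictMono _).monotone h1
        _ = Λ := by rw [hΛ, expTower_succ (i + 1)]
        _ ≤ d * k := hΛd
        _ ≤ y * d := by rw [mul_comm]; gcongr
    exact le_of_mul_le_mul_left h3 (by linarith)
  obtain ⟨hd, hy'⟩ := expTower_iterLog_of_le hlow
  refine ⟨iterLog (i + 1) (d : ℝ), hd.symm, hy', ?_⟩
  rw [logb_le_iff_le_rpow one_lt_two (by linarith)]
  have h2 := two_rpow_mul_expTower_le (i + 1) (show 1 ≤ y by linarith) hlogb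
  rw [rpow_logb two_pos (by norm_num) (by linarith), ← hΛ, expTower_succ] at h2
  exact (expTower_strictMono (i + 1)).le_iff_le.1 (hd.le.trans (hdΛ.trans h2))

/-- One level of the recursion, given a bound on the recursive call. -/
theorem exists_deltaTime_add_two_le {ε : ℝ} (hε0 : 0 < ε) (hε1 : ε < 1) {c : ℕ} (hc : 2 ≤ c) :
    ∃ (B : ℕ) (M : ℝ), 2 ≤ B ∧ 0 ≤ M ∧
      ∀ (i : ℕ) (y : ℝ) (Λ : ℕ) (R : ℝ), 2 ≤ y → (Λ : ℝ) = expTower (i + 1) y → 0 ≤ R →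
        (∀ d k : ℕ, 1 ≤ k → (k : ℝ) ≤ y → y ≤ 2 * k → 1 ≤ d →
          (Λ : ℝ) ≤ d * k → (d : ℝ) * k ≤ B * Λ →
          (deltaTime c ε (i + 1) d : ℝ) ≤ Λ * R) →
        (deltaTime c ε (i + 2) Λ : ℝ) ≤ Λ * (2 * logb 2 y + (M + R)) := by
  obtain ⟨Λ₀, hΛ₀2, hΛ₀⟩ := exists_sq_logb_le hε0
  obtain ⟨B, hB2, hB⟩ := exists_numIterations_le hε0 c
  have hcR : (2 : ℝ) ≤ c := by exact_mod_cast hc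
  have hBR : (2 : ℝ) ≤ B := by exact_mod_cast hB2
  have hΛ₀R : (2 : ℝ) ≤ Λ₀ := by exact_mod_cast hΛ₀2
  set M₀ : ℝ := 2 * (logb 2 (c * Λ₀) + 1) with hM₀
  set M₁ : ℝ := 2 * B + 3 + 2 * logb 2 (B + 2) with hM₁
  have hM₀0 : 0 ≤ M₀ := by
    have := logb_nonneg one_lt_two (show (1 : ℝ) ≤ c * Λ₀ by nlinarith)
    positivity
  have hM₁0 : 0 ≤ M₁ := by
    have := logb_nonneg one_lt_two (show (1 : ℝ) ≤ B + 2 by linarith)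
    positivity
  refine ⟨B, M₀ + M₁, hB2, by positivity, ?_⟩
  intro i y Λ R hy hΛ hR hrec
  have hiter : iterLog (i + 1) (Λ : ℝ) = y := by rw [hΛ, iterLog_expTower]
  rw [deltaTime_add_two, hiter]
  have hylog : y ≤ logb 2 Λ := by
    rw [hΛ, expTower_succ', logb_rpow (by norm_num) (by norm_num)]
    exact le_expTower i (by linarith)
  have hlogy : 0 ≤ logb 2 y := logb_nonneg one_lt_two (by linarith)
  have hΛR : (2 : ℝ) ≤ Λ := by
    rw [hΛ]; exact hy.trans (le_expTower _ (by linarith))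
  have hΛ1 : 1 ≤ Λ := by
    have : (1 : ℝ) ≤ Λ := by linarith
    exact_mod_cast this
  have hky : ((⌊y⌋₊ : ℕ) : ℝ) ≤ y := Nat.floor_le (by linarith)
  have hk2 : 2 ≤ ⌊y⌋₊ := Nat.le_floor (by exact_mod_cast hy)
  have hyk : y ≤ 2 * (⌊y⌋₊ : ℕ) := by
    have h1 := Nat.lt_floor_add_one y
    have h2 : (2 : ℝ) ≤ (⌊y⌋₊ : ℕ) := by exact_mod_cast hk2
    linarith
  have hq := floor_rpow_le hε0 hε1 Λ
  generalize ⌊y⌋₊ = k at hky hk2 hyk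
  have hBk := hB Λ k (by omega)
  have hΛ₀' := hΛ₀ Λ
  generalize ⌊(Λ : ℝ) ^ ε⌋₊ = q at hBk hΛ₀' hq
  dsimp only
  split_ifs with hkq
  · have ht := hBk hkq.2 (hky.trans hylog)
    have hd := le_defect_mul hc hkq.1 hkq.2 hq
    generalize numIterations k q (c * Λ ^ 2) = t at ht hd
    have h1 := level_cost_le hkq.1 hkq.2 hq ht hky
    have h2 := hrec (t * (Λ / k)) k hkq.1 hky hyk
      (by
        rcases Nat.eq_zero_or_pos (t * (Λ / k)) with h | h
        · rw [h] at hd; omega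
        · exact h)
      (by exact_mod_cast hd)
      (by
        have : t * (Λ / k) * k ≤ B * Λ := by
          rw [mul_assoc]
          exact Nat.mul_le_mul ht (Nat.div_mul_le_self _ _)
        exact_mod_cast this)
    have h3 : 0 ≤ (Λ : ℝ) * M₀ := by positivity
    push_cast at h1 h2 ⊢
    rw [← hM₁] at h1
    linarith
  -- The requirements on `k` and `q` fail only for small `Λ`, where `M₀` pays for the direct use of
  -- the Kuhn–Wattenhofer procedure.
  · have hlt : Λ < Λ₀ := by
      by_contra! hge
      have h1 := hΛ₀' hge
      have h2 : (q : ℝ) ≤ (k : ℝ) ^ 2 := by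
        have : q ≤ k ^ 2 := by
          by_contra! h
          exact hkq ⟨by omega, h⟩
        exact_mod_cast this
      have h3 : (k : ℝ) ^ 2 ≤ logb 2 Λ ^ 2 :=
        pow_le_pow_left₀ (Nat.cast_nonneg k) (hky.trans hylog) 2
      have h4 : (Λ : ℝ) ^ (-(ε / 2)) < 1 :=
        rpow_lt_one_of_one_lt_of_neg (by linarith) (by linarith)
      have h5 : (2 : ℝ) ≤ k := by exact_mod_cast hk2
      have h6 := mul_le_mul_of_nonneg_left h2
          (rpow_nonneg (by linarith) (-(ε / 2)) : 0 ≤ (Λ : ℝ) ^ (-(ε / 2)))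
      have h7 : (4 : ℝ) ≤ (k : ℝ) ^ 2 := by nlinarith
      nlinarith
    have h1 := kwTime_mul_sq_le (x := c * Λ₀) (by omega : 1 ≤ c) hΛ1 (by
      have : (Λ : ℝ) ≤ Λ₀ := by exact_mod_cast hlt.le
      gcongr)
    have h2 : 0 ≤ (Λ : ℝ) * (2 * logb 2 y + (M₁ + R)) := by positivity
    rw [hM₀]
    linarith

theorem exists_deltaTime_le {ε : ℝ} (hε0 : 0 < ε) (hε1 : ε < 1) {c : ℕ} (hc : 2 ≤ c) :
    ∃ (B : ℕ) (A : ℝ), 1 ≤ B ∧ 0 ≤ A ∧ ∀ (i : ℕ) (y : ℝ) (Λ : ℕ), 2 ≤ y →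
      (Λ : ℝ) = expTower (i + 1) y →
      (deltaTime c ε (i + 2) Λ : ℝ) ≤ Λ * (2 * logb 2 y + A * levelWeight B y) := by
  obtain ⟨B, M₁, hB2, hM₁0, hlevel⟩ := exists_deltaTime_add_two_le hε0 hε1 hc
  have hcR : (2 : ℝ) ≤ c := by exact_mod_cast hc
  have hBR : (2 : ℝ) ≤ B := by exact_mod_cast hB2
  set M₂ : ℝ := 2 * B * (logb 2 (c * B) + 3) with hM₂
  set M₃ : ℝ := 2 * B * (2 + logb 2 B) with hM₃
  have hlogB : 0 ≤ logb 2 B := logb_nonneg one_lt_two (by linarith)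
  have hlogcB : 0 ≤ logb 2 (c * B : ℝ) := logb_nonneg one_lt_two (by nlinarith)
  have hM₂0 : 0 ≤ M₂ := by positivity
  have hM₃0 : 0 ≤ M₃ := by positivity
  refine ⟨B, 2 * (M₁ + M₂ + M₃), by omega, by positivity, fun i => ?_⟩
  -- The factor 2 makes `A / 2`, the spare part in `mul_levelWeight_add_one_le`, cover the additive
  -- constants of a level.
  set A := 2 * (M₁ + M₂ + M₃) with hA
  have hA0 : 0 ≤ A := by positivity
  induction i with
  | zero =>
    intro y Λ hy hΛ
    -- At the bottom `log Λ = y ≤ 2 * k`, so the `O(d * log Λ)` rounds of the Kuhn–Wattenhofer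
    -- procedure are `O(d * k) = O(Λ)`.
    refine (hlevel 0 y Λ M₂ hy hΛ hM₂0 fun d k hk hky hyk hd1 _ hdk => ?_).trans ?_
    · have hk1 : (1 : ℝ) ≤ k := by exact_mod_cast hk
      have hΛ2 : (Λ : ℝ) = 2 ^ y := hΛ
      have hΛpos : (0 : ℝ) < Λ := by rw [hΛ2]; positivity
      have hdΛ : (d : ℝ) ≤ B * Λ := by
        have : (d : ℝ) * 1 ≤ d * k := by gcongr
        linarith
      have h1 : (kwTime d (c * d ^ 2) : ℝ) ≤ 2 * d * (logb 2 (c * B * Λ) + 1) :=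
        kwTime_mul_sq_le (by omega) hd1 (by rw [mul_assoc]; gcongr)
      rw [logb_mul (by positivity) hΛpos.ne', hΛ2, logb_rpow (by norm_num) (by norm_num)] at h1
      calc (kwTime d (c * d ^ 2) : ℝ) ≤ 2 * d * (logb 2 (c * B) + y + 1) := h1
        _ ≤ 2 * d * (k * (logb 2 (c * B) + 3)) := by gcongr; nlinarith
        _ = 2 * (d * k) * (logb 2 (c * B) + 3) := by ring
        _ ≤ 2 * (B * Λ) * (logb 2 (c * B) + 3) := by gcongr
        _ = Λ * M₂ := by rw [hM₂]; ring
    · have := one_le_levelWeight B y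
      gcongr
      nlinarith
  | succ i ih =>
    intro y Λ hy hΛ
    have hw := mul_levelWeight_add_one_le (by omega : 1 ≤ B) hy
    have hw1 := one_le_levelWeight B (y + 1)
    have hlogy : 0 ≤ logb 2 y := logb_nonneg one_lt_two (by linarith)
    refine (hlevel (i + 1) y Λ (M₃ + A * (2 * B / y * levelWeight B (y + 1))) hy hΛ
      (by positivity) fun d k hk hky hyk hd1 hΛd hdk => ?_).trans ?_
    · have hk1 : (1 : ℝ) ≤ k := by exact_mod_cast hk
      have hΛpos : (0 : ℝ) < Λ := by
        rw [hΛ]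
        have := le_expTower (i + 1 + 1) (y := y) (by linarith)
        linarith
      have hdΛ : (d : ℝ) ≤ B * Λ := by
        have : (d : ℝ) * 1 ≤ d * k := by gcongr
        linarith
      obtain ⟨y', hd, hy', hupp⟩ := exists_expTower_eq_of_recursion hy hΛ (by linarith) hky hΛd hdΛ
      have hlogy' : 0 ≤ logb 2 y' := logb_nonneg one_lt_two (by linarith)
      have hih := ih y' d (by linarith) hd
      have hanti := levelWeight_antitone (by omega : 1 ≤ B) hy'
      have hdB : (d : ℝ) ≤ Λ * (2 * B / y) := by
        rw [mul_div_assoc', le_div_iff₀ (by linarith)]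
        calc (d : ℝ) * y ≤ d * (2 * k) := by gcongr
          _ = 2 * (d * k) := by ring
          _ ≤ 2 * (B * Λ) := by gcongr
          _ = _ := by ring
      -- The logarithmic term of the recursive call is about `y`, and `d * y = O(d * k) = O(Λ)`.
      have hyB : (d : ℝ) * (2 * (y + logb 2 B)) ≤ Λ * M₃ := by
        have h1 : y + logb 2 B ≤ k * (2 + logb 2 B) := by
          have := mul_nonneg (sub_nonneg.2 hk1) hlogB
          linarith
        calc (d : ℝ) * (2 * (y + logb 2 B)) ≤ d * (2 * (k * (2 + logb 2 B))) := by gcongr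
          _ = 2 * (d * k) * (2 + logb 2 B) := by ring
          _ ≤ 2 * (B * Λ) * (2 + logb 2 B) := by gcongr
          _ = _ := by rw [hM₃]; ring
      calc (deltaTime c ε (i + 2) d : ℝ) ≤ d * (2 * logb 2 y' + A * levelWeight B y') := hih
        _ ≤ d * (2 * (y + logb 2 B) + A * levelWeight B (y + 1)) := by gcongr
        _ = d * (2 * (y + logb 2 B)) + d * (A * levelWeight B (y + 1)) := by ring
        _ ≤ Λ * M₃ + Λ * (2 * B / y) * (A * levelWeight B (y + 1)) := by gcongr
        _ = _ := by ring
    · gcongr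
      have := mul_le_mul_of_nonneg_left hw hA0
      linarith

theorem exists_deltaTime_logStar_le {ε : ℝ} (hε0 : 0 < ε) (hε1 : ε < 1) {c : ℕ} (hc : 2 ≤ c) :
    ∃ C : ℝ, 0 ≤ C ∧ ∀ Λ : ℕ, 1 ≤ Λ → (deltaTime c ε (logStar Λ) Λ : ℝ) ≤ C * Λ := by
  obtain ⟨B, A, hB, hA, h⟩ := exists_deltaTime_le hε0 hε1 hc
  have hcR : (2 : ℝ) ≤ c := by exact_mod_cast hc
  have hw := one_le_levelWeight B 2
  have hlog : 0 ≤ logb 2 (c * 4 : ℝ) := logb_nonneg one_lt_two (by linarith)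
  refine ⟨2 * (logb 2 (c * 4) + 1) + (4 + A * levelWeight B 2), by positivity, fun Λ hΛ => ?_⟩
  have hΛ1 : (1 : ℝ) ≤ Λ := by exact_mod_cast hΛ
  have hsmall : (Λ : ℝ) ≤ 4 → (kwTime Λ (c * Λ ^ 2) : ℝ) ≤
      (2 * (logb 2 (c * 4) + 1) + (4 + A * levelWeight B 2)) * Λ := by
    intro h4
    have h1 := kwTime_mul_sq_le (x := c * 4) (by omega : 1 ≤ c) hΛ (by gcongr)
    have h2 : 0 ≤ (4 + A * levelWeight B 2) * Λ := by positivity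
    linarith
  have hstar := iterLog_logStar_le Λ
  have htower := fun i => expTower_iterLog_logStar (n := Λ) (i := i)
  have htwo := fun i => two_lt_iterLog (n := Λ) (i := i)
  generalize logStar Λ = L at hstar htower htwo
  match L with
  | 0 =>
    refine hsmall ?_
    have h1 : (Λ : ℝ) ≤ 2 := hstar
    linarith
  | 1 =>
    refine hsmall ?_
    have h1 : logb 2 (Λ : ℝ) ≤ 2 := hstar
    rw [logb_le_iff_le_rpow one_lt_two (by linarith)] at h1
    norm_num at h1
    exact_mod_cast h1
  | i + 2 =>
    -- By the minimality of `logStar` the top `y` exceeds 2, while its logarithm is at most 2.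
    have hy := htwo (i + 1) (by omega)
    have h1 := h i _ Λ hy.le (htower (i + 1) (by omega)).symm
    rw [iterLog_succ'] at hstar
    have h2 := levelWeight_antitone hB hy.le
    have h3 : 0 ≤ 2 * (logb 2 (c * 4 : ℝ) + 1) * Λ := by positivity
    calc _ ≤ _ := h1
      _ ≤ Λ * (2 * 2 + A * levelWeight B 2) := by gcongr
      _ ≤ _ := by linarith

end DeltaTime

/-! ### Color reductions and Linial's algorithm -/

/-- In `T` rounds, a legal `m`-coloring of any graph of maximum degree at most `Δ` can be turned
into a legal `m'`-coloring. -/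
def IsReducible (Δ T m m' : ℕ) : Prop :=
  ∃ A : ℕ → Program ℕ, ∀ (V : Type) (N : V → Finset V) (φ : V → ℕ), IsNetwork N Δ →
    IsLegal N m φ → ∃ out : V → ℕ, RunsIn N T (fun v => A (φ v)) out ∧ IsLegal N m' out

namespace IsReducible

variable {Δ T T' m m' m'' : ℕ}

theorem of_le (h : m ≤ m') : IsReducible Δ 0 m m' :=
  ⟨halt, fun _ _ φ _ hφ => ⟨φ, fun _ => rfl, hφ.mono h⟩⟩

theorem trans (h : IsReducible Δ T m m') (h' : IsReducible Δ T' m' m'') :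
    IsReducible Δ (T + T') m m'' := by
  obtain ⟨A, hA⟩ := h
  obtain ⟨A', hA'⟩ := h'
  refine ⟨fun x => A x >>= A', fun V N φ hN hφ => ?_⟩
  obtain ⟨φ', h1, hφ'⟩ := hA V N φ hN hφ
  obtain ⟨out, h2, hout⟩ := hA' V N φ' hN hφ'
  exact ⟨out, h1.bind (f := fun _ => A') h2, hout⟩

theorem mono_left (h : IsReducible Δ T m' m'') (hm : m ≤ m') : IsReducible Δ T m m'' := by
  have := (of_le hm).trans h
  rwa [Nat.zero_add] at this

theorem mono_right (h : IsReducible Δ T m m') (hm : m' ≤ m'') : IsReducible Δ T m m'' :=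
  h.trans (of_le hm)

/-- Linial's color reduction. -/
theorem linial {D : ℕ} (hΔ : 1 ≤ Δ) (hD : 1 ≤ D) (hm : m ≤ (Δ * D) ^ (D + 1)) :
    IsReducible Δ 1 m (4 * (Δ * D) ^ 2) :=
  ⟨coverFreeStep Δ m (4 * (Δ * D) ^ 2), fun _ _ _ hN hφ =>
    exists_runsIn_coverFreeStep (exists_isCoverFree_sq hΔ hD hm) hN hφ⟩

theorem linial_two_pow {D : ℕ} (hΔ : 1 ≤ Δ) (hD : 2 ≤ D) :
    IsReducible Δ 1 (2 ^ D) (4 * (Δ * D) ^ 2) := by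
  refine linial hΔ (by omega) ?_
  have h : 2 ≤ Δ * D := by nlinarith
  exact (Nat.pow_le_pow_left h D).trans (Nat.pow_le_pow_right (by omega) (Nat.le_succ D))

theorem linial_two_pow_two_pow {x y : ℕ} (hΔ : 1 ≤ Δ) (hx : 1 ≤ x) (hy : 2 * x + 2 * Δ + 2 ≤ y) :
    IsReducible Δ 1 (2 ^ 2 ^ x) (2 ^ y) := by
  refine (linial_two_pow hΔ (Nat.le_self_pow (by omega) 2)).mono_right ?_
  calc 4 * (Δ * 2 ^ x) ^ 2 ≤ 4 * (2 ^ Δ * 2 ^ x) ^ 2 := by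
        gcongr; exact Nat.lt_two_pow_self.le
    _ = 2 ^ (2 * x + 2 * Δ + 2) := by ring
    _ ≤ 2 ^ y := Nat.pow_le_pow_right two_pos hy

/-- The palette is a tower of fixed height over `Δ`. Three rounds bring it down to `2 ^ (4 * Δ +
14)` and a fourth to a polynomial in `Δ`; degrees 5 and 4 then give the quadratic bound. -/
theorem iterated_linial (hΔ : 1 ≤ Δ) :
    IsReducible Δ 6 (2 ^ 2 ^ (2 * 2 ^ 2 ^ (Δ + 2) + 2)) (64 * Δ ^ 2) := by
  have h1 : Δ + 2 < 2 ^ (Δ + 2) := Nat.lt_two_pow_self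
  have h2 : 2 ^ (Δ + 2) < 2 ^ 2 ^ (Δ + 2) := Nat.lt_two_pow_self
  have s1 : IsReducible Δ 1 (2 ^ 2 ^ (2 * 2 ^ 2 ^ (Δ + 2) + 2)) (2 ^ 2 ^ (2 ^ (Δ + 2) + 4)) := by
    refine linial_two_pow_two_pow hΔ (by omega) ?_
    rw [pow_add 2 (2 ^ (Δ + 2)) 4]
    omega
  have s2 : IsReducible Δ 1 (2 ^ 2 ^ (2 ^ (Δ + 2) + 4)) (2 ^ 2 ^ (Δ + 6)) := by
    refine linial_two_pow_two_pow hΔ (by omega) ?_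
    rw [show Δ + 6 = Δ + 2 + 4 by ring, pow_add 2 (Δ + 2) 4]
    omega
  have s3 : IsReducible Δ 1 (2 ^ 2 ^ (Δ + 6)) (2 ^ (4 * Δ + 14)) :=
    linial_two_pow_two_pow hΔ (by omega) (by omega)
  have s4 : IsReducible Δ 1 (2 ^ (4 * Δ + 14)) ((Δ * 5) ^ (5 + 1)) := by
    refine (linial_two_pow hΔ (by omega)).mono_right ?_
    calc 4 * (Δ * (4 * Δ + 14)) ^ 2 ≤ 4 * (Δ * (18 * Δ)) ^ 2 := by gcongr; omega
      _ = 1296 * Δ ^ 4 * 1 := by ring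
      _ ≤ 15625 * Δ ^ 4 * Δ ^ 2 :=
        Nat.mul_le_mul (Nat.mul_le_mul_right _ (by norm_num)) (Nat.one_le_pow _ _ hΔ)
      _ = _ := by ring
  have s5 : IsReducible Δ 1 ((Δ * 5) ^ (5 + 1)) ((Δ * 4) ^ (4 + 1)) := by
    refine (linial hΔ (by norm_num) le_rfl).mono_right ?_
    calc 4 * (Δ * 5) ^ 2 = 100 * Δ ^ 2 * 1 := by ring
      _ ≤ 1024 * Δ ^ 2 * Δ ^ 3 :=
        Nat.mul_le_mul (Nat.mul_le_mul_right _ (by norm_num)) (Nat.one_le_pow _ _ hΔ)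
      _ = _ := by ring
  have s6 : IsReducible Δ 1 ((Δ * 4) ^ (4 + 1)) (64 * Δ ^ 2) :=
    (linial hΔ (by norm_num) le_rfl).mono_right (by ring_nf; exact le_rfl)
  exact ((((s1.trans s2).trans s3).trans s4).trans s5).trans s6

end IsReducible

/-! ### Coloring arcs by differing bits -/

section ArcColor

/-- The lowest position at which the binary expansions of `x` and `y` differ. -/
noncomputable def diffIndex (x y : ℕ) : ℕ := sInf {i : ℕ | x.testBit i ≠ y.testBit i}

theorem testBit_diffIndex_ne {x y : ℕ} (h : x ≠ y) :
    x.testBit (diffIndex x y) ≠ y.testBit (diffIndex x y) := by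
  refine Nat.sInf_mem (s := {i : ℕ | x.testBit i ≠ y.testBit i}) ?_
  by_contra hemp
  refine h (Nat.eq_of_testBit_eq fun i => ?_)
  by_contra hi
  exact hemp ⟨i, hi⟩

theorem diffIndex_lt {x y l : ℕ} (h : x ≠ y) (hx : x < 2 ^ l) (hy : y < 2 ^ l) :
    diffIndex x y < l := by
  by_contra! hl
  have hle := Nat.pow_le_pow_right two_pos hl
  refine testBit_diffIndex_ne h ?_
  rw [Nat.testBit_lt_two_pow (hx.trans_le hle), Nat.testBit_lt_two_pow (hy.trans_le hle)]

/-- A color of the arc from `x` to `y`; consecutive arcs have different colors. -/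
noncomputable def arcColor (x y : ℕ) : ℕ := 2 * diffIndex x y + (x.testBit (diffIndex x y)).toNat

theorem arcColor_lt {x y l : ℕ} (h : x ≠ y) (hx : x < 2 ^ l) (hy : y < 2 ^ l) :
    arcColor x y < 2 * l := by
  have h1 := diffIndex_lt h hx hy
  have h2 := Bool.toNat_le (x.testBit (diffIndex x y))
  unfold arcColor
  omega

/-- Equal colors would mean the same bit position and the same bit of `x` and `y` there, but at this
position `y` and `x` differ. -/
theorem arcColor_ne {x y : ℕ} (z : ℕ) (h : y ≠ x) : arcColor x z ≠ arcColor y x := by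
  intro heq
  unfold arcColor at heq
  have h1 := Bool.toNat_le (x.testBit (diffIndex x z))
  have h2 := Bool.toNat_le (y.testBit (diffIndex y x))
  have hi : diffIndex x z = diffIndex y x := by omega
  rw [hi] at heq
  refine testBit_diffIndex_ne h ?_
  have hb := Nat.add_left_cancel heq
  cases hx : x.testBit (diffIndex y x) <;> cases hy : y.testBit (diffIndex y x) <;> simp_all

end ArcColor

/-! ### Sets as colors -/

section EncodeFinset

/-- An encoding of the finite subsets of `{0, …, M - 1}`. -/
def encodeFinset (M : ℕ) (W : Finset ℕ) : ℕ := Nat.ofDigits (M + 1) ((W.sort (· ≤ ·)).map (· + 1))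

theorem encodeFinset_lt {M n : ℕ} {W : Finset ℕ} (hM : 1 ≤ M) (hW : W ⊆ Finset.range M)
    (hcard : W.card ≤ n) : encodeFinset M W < (M + 1) ^ n := by
  refine (Nat.ofDigits_lt_base_pow_length (by omega) ?_).trans_le
    (Nat.pow_le_pow_right (by omega) (by simpa using hcard))
  intro x hx
  obtain ⟨y, hy, rfl⟩ := List.mem_map.1 hx
  have := Finset.mem_range.1 (hW ((Finset.mem_sort _).1 hy))
  omega

/-- The shift by 1 excludes the digit 0, so no leading digit is lost and the set can be recovered.
-/
theorem digits_encodeFinset {M : ℕ} {W : Finset ℕ} (hM : 1 ≤ M) (hW : W ⊆ Finset.range M) :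
    Nat.digits (M + 1) (encodeFinset M W) = (W.sort (· ≤ ·)).map (· + 1) := by
  refine Nat.digits_ofDigits _ (by omega) _ ?_ ?_
  · intro x hx
    obtain ⟨y, hy, rfl⟩ := List.mem_map.1 hx
    have := Finset.mem_range.1 (hW ((Finset.mem_sort _).1 hy))
    omega
  · intro h hlast
    obtain ⟨y, -, hy⟩ := List.mem_map.1 (List.getLast_mem h)
    omega

theorem encodeFinset_inj {M : ℕ} {W W' : Finset ℕ} (hM : 1 ≤ M) (hW : W ⊆ Finset.range M)
    (hW' : W' ⊆ Finset.range M) (h : encodeFinset M W = encodeFinset M W') : W = W' := by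
  have h1 := digits_encodeFinset hM hW
  rw [h, digits_encodeFinset hM hW'] at h1
  have h2 := List.map_injective_iff.2 (add_left_injective 1) h1
  rw [← Finset.sort_toFinset (r := (· ≤ ·)) W, ← h2, Finset.sort_toFinset]

end EncodeFinset

/-! ### The Szegedy–Vishwanathan algorithm -/

section SzegedyVishwanathan

/-- The new color of a vertex of color `x` whose neighbours have the colors in `S`, in a round of
the Szegedy–Vishwanathan algorithm: for every arc to a neighbour, choose an element of the set of
its color that lies in none of the sets of the colors of the arcs from the neighbours. -/
noncomputable def arcChoice (T : ℕ → Finset ℕ) (x : ℕ) (S : Finset ℕ) : Finset ℕ :=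
  S.image fun y => sInf {t : ℕ | t ∈ T (arcColor x y) ∧ ∀ z ∈ S, t ∉ T (arcColor z x)}

theorem arcChoice_spec {Δ l M x : ℕ} {T : ℕ → Finset ℕ} {S : Finset ℕ}
    (hT : IsCoverFree Δ (2 * l) M T) (hx : x < 2 ^ l) (hS : ∀ y ∈ S, y < 2 ^ l) (hxS : x ∉ S)
    (hcard : S.card ≤ Δ) {y : ℕ} (hy : y ∈ S) :
    sInf {t : ℕ | t ∈ T (arcColor x y) ∧ ∀ z ∈ S, t ∉ T (arcColor z x)} ∈
      {t : ℕ | t ∈ T (arcColor x y) ∧ ∀ z ∈ S, t ∉ T (arcColor z x)} := by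
  have hne : ∀ z ∈ S, z ≠ x := fun z hz h => hxS (h ▸ hz)
  have h := hT.2 (arcColor x y) (arcColor_lt (hne y hy).symm hx (hS y hy))
    (S.image fun z => arcColor z x)
    (fun o ho => by
      obtain ⟨z, hz, rfl⟩ := Finset.mem_image.1 ho
      exact Finset.mem_range.2 (arcColor_lt (hne z hz) (hS z hz) hx))
    (Finset.card_image_le.trans hcard)
    (fun ho => by
      obtain ⟨z, hz, h⟩ := Finset.mem_image.1 ho
      exact arcColor_ne y (hne z hz) h.symm)
  obtain ⟨t, ht, ht'⟩ := Finset.not_subset.1 h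
  exact Nat.sInf_mem ⟨t, ht, fun z hz htz =>
    ht' (Finset.mem_biUnion.2 ⟨_, Finset.mem_image_of_mem _ hz, htz⟩)⟩

/-- One round of the Szegedy–Vishwanathan algorithm, for a vertex of color `x`. -/
noncomputable def arcStep (T : ℕ → Finset ℕ) (M x : ℕ) : Program ℕ := do
  let R ← exchange [x]
  pure (encodeFinset M (arcChoice T x (R.map fun m => m.getD 0 0).toFinset))

theorem runsIn_arcStep {V : Type} (N : V → Finset V) (φ : V → ℕ) (T : ℕ → Finset ℕ) (M : ℕ) :
    RunsIn N 1 (fun v => arcStep T M (φ v))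
      (fun v => encodeFinset M (arcChoice T (φ v) ((N v).image φ))) := by
  have h := RunsIn.exchange_pure (N := N) (fun v => [φ v]) (fun v R =>
    encodeFinset M (arcChoice T (φ v) (R.map fun m => m.getD 0 0).toFinset))
  have hS : ∀ v, (((N v).val.map fun u => [φ u]).map fun m : List ℕ => m.getD 0 0).toFinset =
      (N v).image φ := by
    intro v
    rw [Multiset.map_map]
    rfl
  simp only [hS] at h
  exact h

/-- If adjacent `u` and `v` received the same set, the element chosen for the arc from `u` to `v`
would also be a choice of `v`. But the choices of `v` avoid the family member of every arc into `v`,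
in particular of this one. -/
theorem IsReducible.szegedyVishwanathan {Δ l M : ℕ} (hM : 1 ≤ M)
    (hT : ∃ T, IsCoverFree Δ (2 * l) M T) : IsReducible Δ 1 (2 ^ l) ((M + 1) ^ Δ) := by
  obtain ⟨T, hT⟩ := hT
  refine ⟨arcStep T M, fun V N φ hN hφ => ⟨_, runsIn_arcStep N φ T M, ?_⟩⟩
  have hspec : ∀ v, ∀ y ∈ (N v).image φ,
      sInf {t : ℕ | t ∈ T (arcColor (φ v) y) ∧ ∀ z ∈ (N v).image φ, t ∉ T (arcColor z (φ v))} ∈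
        {t : ℕ | t ∈ T (arcColor (φ v) y) ∧ ∀ z ∈ (N v).image φ, t ∉ T (arcColor z (φ v))} := by
    intro v y hy
    refine arcChoice_spec hT (hφ.lt v) (fun y hy => ?_) (fun h => ?_)
      (Finset.card_image_le.trans (hN.card_le v)) hy
    · obtain ⟨u, -, rfl⟩ := Finset.mem_image.1 hy
      exact hφ.lt u
    · obtain ⟨u, hu, he⟩ := Finset.mem_image.1 h
      exact hφ.ne v u hu he
  have hsub : ∀ v, arcChoice T (φ v) ((N v).image φ) ⊆ Finset.range M := by
    intro v t ht
    obtain ⟨y, hy, rfl⟩ := Finset.mem_image.1 ht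
    obtain ⟨u, hu, rfl⟩ := Finset.mem_image.1 hy
    exact hT.1 _ (arcColor_lt (hφ.ne v u hu).symm (hφ.lt v) (hφ.lt u)) (hspec v _ hy).1
  refine ⟨fun v => encodeFinset_lt hM (hsub v) (Finset.card_image_le.trans
    (Finset.card_image_le.trans (hN.card_le v))), fun v u hu heq => ?_⟩
  have hW := encodeFinset_inj hM (hsub u) (hsub v) heq
  have hv : φ v ∈ (N u).image φ := Finset.mem_image_of_mem φ (hN.symm u v hu)
  have h1 : sInf {t : ℕ | t ∈ T (arcColor (φ u) (φ v)) ∧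
      ∀ z ∈ (N u).image φ, t ∉ T (arcColor z (φ u))} ∈ arcChoice T (φ u) ((N u).image φ) :=
    Finset.mem_image_of_mem _ hv
  have h2 := (hspec u _ hv).1
  rw [hW] at h1
  obtain ⟨y, hy, he⟩ := Finset.mem_image.1 h1
  rw [← he] at h2
  exact (hspec v y hy).2 (φ u) (Finset.mem_image_of_mem φ hu) h2

/-- The iterates of `x ↦ 2 ^ 2 ^ x`, starting with `1`. -/
def doubleTower : ℕ → ℕ
  | 0 => 1
  | j + 1 => 2 ^ 2 ^ doubleTower j

theorem doubleTower_lt_succ (j : ℕ) : doubleTower j < doubleTower (j + 1) :=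
  Nat.lt_two_pow_self.trans Nat.lt_two_pow_self

theorem doubleTower_mono : Monotone doubleTower :=
  monotone_nat_of_le_succ fun j => (doubleTower_lt_succ j).le

theorem le_doubleTower (j : ℕ) : j ≤ doubleTower j :=
  (strictMono_nat_of_lt_succ doubleTower_lt_succ).id_le j

/-- The sizes of the palettes in the Szegedy–Vishwanathan algorithm, in reverse order. -/
def svPalette (j : ℕ) : ℕ := 2 ^ 2 ^ (2 * doubleTower j + 2)

/-- With `e = 2 ^ y` the new palette has `2 ^ (O(Δ + y) * Δ)` colors. As `Δ ≤ y / 4`, the exponent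
is at most `4 * y ^ 2 = 2 ^ (2 * doubleTower j + 2)`, which explains the shape of `svPalette`. -/
theorem IsReducible.svPalette_succ {Δ j : ℕ} (hΔ : 1 ≤ Δ) (hj : Δ + 2 ≤ doubleTower j) :
    IsReducible Δ 1 (svPalette (j + 1)) (svPalette j) := by
  unfold svPalette
  set e := doubleTower (j + 1) with he
  -- The degree `2 * e + 3` is the binary logarithm of the number of arc colors.
  have hT : ∃ T, IsCoverFree Δ (2 * 2 ^ (2 * e + 2)) (4 * (Δ * (2 * e + 3)) ^ 2) T := by
    refine exists_isCoverFree_sq hΔ (by omega) ?_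
    have h : 2 ≤ Δ * (2 * e + 3) := by nlinarith
    calc 2 * 2 ^ (2 * e + 2) = 2 ^ (2 * e + 3) := by ring
      _ ≤ (Δ * (2 * e + 3)) ^ (2 * e + 3) := Nat.pow_le_pow_left h _
      _ ≤ _ := Nat.pow_le_pow_right (by omega) (Nat.le_succ _)
  have hM : 1 ≤ (Δ * (2 * e + 3)) ^ 2 := Nat.one_le_pow _ _ (by positivity)
  refine (IsReducible.szegedyVishwanathan (by omega) hT).mono_right ?_
  set y := 2 ^ doubleTower j with hy
  have hey : e = 2 ^ y := rfl
  have hy1 : 2 ^ (Δ + 2) ≤ y := Nat.pow_le_pow_right two_pos hj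
  have hΔ2 : Δ + 1 ≤ 2 ^ Δ := Nat.lt_two_pow_self
  have hy2 : 4 * Δ + 4 ≤ y := by rw [pow_add] at hy1; omega
  have he1 : 1 ≤ e := by rw [hey]; exact Nat.one_le_two_pow
  have hbase : 4 * (Δ * (2 * e + 3)) ^ 2 + 1 ≤ 2 ^ (8 + 2 * Δ + 2 * y) := by
    calc 4 * (Δ * (2 * e + 3)) ^ 2 + 1 ≤ 5 * (Δ * (2 * e + 3)) ^ 2 := by omega
      _ ≤ 5 * (2 ^ Δ * (5 * e)) ^ 2 := by gcongr <;> omega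
      _ = 125 * (2 ^ Δ * 2 ^ y) ^ 2 := by rw [hey]; ring
      _ ≤ 256 * (2 ^ Δ * 2 ^ y) ^ 2 := by gcongr; norm_num
      _ = _ := by ring
  calc (4 * (Δ * (2 * e + 3)) ^ 2 + 1) ^ Δ ≤ (2 ^ (8 + 2 * Δ + 2 * y)) ^ Δ :=
        Nat.pow_le_pow_left hbase _
    _ = 2 ^ ((8 + 2 * Δ + 2 * y) * Δ) := (pow_mul _ _ _).symm
    _ ≤ 2 ^ (4 * y ^ 2) := Nat.pow_le_pow_right two_pos (by nlinarith)
    _ = 2 ^ 2 ^ (2 * doubleTower j + 2) := by congr 1; rw [hy]; ring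

/-- Arc rounds are used as long as the tower dominates `Δ + 2`. At the first index where it does,
the previous value is below `Δ + 2`, so `iterated_linial` applies. -/
theorem IsReducible.exists_of_svPalette {Δ : ℕ} (hΔ : 1 ≤ Δ) (J : ℕ) :
    ∃ T ≤ J + 6, IsReducible Δ T (svPalette J) (64 * Δ ^ 2) := by
  have hex : ∃ j, Δ + 2 ≤ doubleTower j := ⟨_, le_doubleTower (Δ + 2)⟩
  obtain ⟨i, hi⟩ : ∃ i, Nat.find hex = i + 1 := by
    refine Nat.exists_eq_succ_of_ne_zero fun h => ?_
    have := Nat.find_spec hex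
    rw [h] at this
    exact absurd this (by simp [doubleTower])
  have hspec : Δ + 2 ≤ doubleTower (i + 1) := hi ▸ Nat.find_spec hex
  have hmin : doubleTower i < Δ + 2 := not_le.1 (Nat.find_min hex (by omega))
  have hlin : IsReducible Δ 6 (svPalette (i + 1)) (64 * Δ ^ 2) := by
    refine (IsReducible.iterated_linial hΔ).mono_left ?_
    unfold svPalette
    rw [doubleTower]
    gcongr <;> norm_num
  have hchain : ∀ s, IsReducible Δ s (svPalette (i + 1 + s)) (svPalette (i + 1)) := by
    intro s
    induction s with
    | zero => exact IsReducible.of_le le_rfl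
    | succ s ih =>
      rw [add_comm s 1]
      refine IsReducible.trans ?_ ih
      rw [← add_assoc, add_right_comm]
      exact IsReducible.svPalette_succ hΔ (hspec.trans (doubleTower_mono (Nat.le_add_right _ _)))
  rcases le_total J (i + 1) with h | h
  · refine ⟨6, by omega, hlin.mono_left ?_⟩
    unfold svPalette
    have := doubleTower_mono h
    gcongr <;> norm_num
  · obtain ⟨s, rfl⟩ := Nat.exists_eq_add_of_le h
    exact ⟨s + 6, by omega, (hchain s).trans hlin⟩

theorem doubleTower_eq_expTower (j : ℕ) : (doubleTower j : ℝ) = expTower (2 * j) 1 := by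
  induction j with
  | zero => simp [doubleTower, expTower_zero]
  | succ j ih =>
    rw [mul_add, mul_one, expTower_succ', expTower_succ', ← ih, doubleTower]
    push_cast
    rw [← rpow_natCast, Nat.cast_pow, ← rpow_natCast]
    norm_num

theorem expTower_add (i j : ℕ) (y : ℝ) : expTower (i + j) y = expTower i (expTower j y) :=
  Function.iterate_add_apply _ _ _ _

theorem pow_add_one_le_two_pow_two_pow (n a : ℕ) : n ^ a + 1 ≤ 2 ^ 2 ^ (n + a) := by
  have h1 : n + 1 ≤ 2 ^ n := Nat.lt_two_pow_self
  have h2 : a + 1 ≤ 2 ^ a := Nat.lt_two_pow_self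
  calc n ^ a + 1 ≤ (2 ^ n) ^ a + (2 ^ n) ^ a :=
        Nat.add_le_add (Nat.pow_le_pow_left (by omega) a) (Nat.one_le_pow _ _ (by positivity))
    _ = 2 ^ (n * a + 1) := by rw [← pow_mul]; ring
    _ ≤ 2 ^ 2 ^ (n + a) := by
      refine Nat.pow_le_pow_right two_pos ?_
      rw [pow_add]
      calc n * a + 1 ≤ (n + 1) * (a + 1) := by nlinarith
        _ ≤ _ := Nat.mul_le_mul h1 h2

/-- `n` lies below a tower of height `logStar n + 1` over 1. Adding `a` costs at most `a` further
levels, and passing from `n + a` to `n ^ a + 1` costs two. -/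
theorem pow_add_one_le_svPalette {n a J : ℕ} (hJ : a + logStar n + 3 ≤ 2 * J) :
    n ^ a + 1 ≤ svPalette J := by
  have h1 : ((n ^ a + 1 : ℕ) : ℝ) ≤ doubleTower J := by
    set s := logStar n
    have hn : (n : ℝ) ≤ expTower (s + 1) 1 := by
      have := le_expTower_logStar n
      rwa [expTower_succ, rpow_one]
    have hna : (n : ℝ) + a ≤ expTower (a + (s + 1)) 1 := by
      rw [expTower_add]
      have := add_le_expTower a (le_expTower (s + 1) le_rfl)
      linarith
    rw [doubleTower_eq_expTower]
    calc ((n ^ a + 1 : ℕ) : ℝ) ≤ ((2 ^ 2 ^ (n + a) : ℕ) : ℝ) :=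
          Nat.cast_le.2 (pow_add_one_le_two_pow_two_pow n a)
      _ = expTower 2 ((n : ℝ) + a) := by
          rw [expTower_succ', expTower_succ', expTower_zero]
          push_cast
          rw [← rpow_natCast, Nat.cast_pow, ← rpow_natCast]
          norm_num
      _ ≤ expTower 2 (expTower (a + (s + 1)) 1) := (expTower_strictMono 2).monotone hna
      _ = expTower (2 + (a + (s + 1))) 1 := (expTower_add _ _ _).symm
      _ ≤ expTower (2 * J) 1 := by
          obtain ⟨r, hr⟩ := Nat.exists_eq_add_of_le' (show 2 + (a + (s + 1)) ≤ 2 * J by omega)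
          rw [hr, expTower_add r]
          exact le_expTower r (le_expTower _ le_rfl)
  refine (Nat.cast_le.1 h1).trans ?_
  unfold svPalette
  calc doubleTower J ≤ 2 * doubleTower J + 2 := by omega
    _ ≤ _ := (Nat.lt_two_pow_self.trans Nat.lt_two_pow_self).le

/-- The Szegedy–Vishwanathan algorithm. -/
theorem exists_svAlgorithm (a : ℕ) : ∃ sv : DistAlgorithm ℕ, ∀ n Δ : ℕ, 1 ≤ Δ →
    ∃ T : ℕ, (T : ℝ) ≤ (1 / 2) * logStar n + (a / 2 + 8) ∧
      ∀ (V : Type) (N : V → Finset V) (φ : V → ℕ), IsNetwork N Δ → IsLegal N (n ^ a + 1) φ →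
        ∃ out : V → ℕ, RunsIn N T (fun v => sv n Δ (φ v)) out ∧ IsLegal N (64 * Δ ^ 2) out := by
  have key : ∀ n Δ : ℕ, ∃ A : ℕ → Program ℕ, 1 ≤ Δ →
      ∃ T : ℕ, (T : ℝ) ≤ (1 / 2) * logStar n + (a / 2 + 8) ∧
      ∀ (V : Type) (N : V → Finset V) (φ : V → ℕ), IsNetwork N Δ → IsLegal N (n ^ a + 1) φ →
        ∃ out : V → ℕ, RunsIn N T (fun v => A (φ v)) out ∧ IsLegal N (64 * Δ ^ 2) out := by
    intro n Δ
    by_cases hΔ : 1 ≤ Δ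
    -- Each unit of `J` accounts for two levels of the tower; the 4 leaves room for rounding down.
    · obtain ⟨T, hT, hred⟩ := IsReducible.exists_of_svPalette hΔ ((a + logStar n + 4) / 2)
      obtain ⟨A, hA⟩ := hred.mono_left (pow_add_one_le_svPalette (n := n) (a := a) (by omega))
      refine ⟨A, fun _ => ⟨T, ?_, hA⟩⟩
      have h : 2 * T ≤ a + logStar n + 16 := by omega
      have h' : (2 : ℝ) * T ≤ a + logStar n + 16 := by exact_mod_cast h
      linarith
    · exact ⟨halt, fun h => absurd h hΔ⟩
  choose sv hsv using key
  exact ⟨sv, hsv⟩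

end SzegedyVishwanathan

/-! ### Assembling the theorem -/

theorem isSVAlgorithm_of_forall {a : ℕ} {K : ℝ} {sv : DistAlgorithm ℕ}
    (h : ∀ n Δ : ℕ, 1 ≤ Δ → ∃ T : ℕ, (T : ℝ) ≤ (1 / 2) * logStar n + K ∧
      ∀ (V : Type) (N : V → Finset V) (φ : V → ℕ), IsNetwork N Δ → IsLegal N (n ^ a + 1) φ →
        ∃ out : V → ℕ, RunsIn N T (fun v => sv n Δ (φ v)) out ∧ IsLegal N (64 * Δ ^ 2) out)
    {V : Type} [Fintype V] {G : SimpleGraph V} [DecidableRel G.Adj] {ident : V → ℕ}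
    (hident : IsIdentAssignment a ident) (hΔ : 1 ≤ G.maxDegree) :
    ∃ (T : ℕ) (out : V → ℕ), (T : ℝ) ≤ (1 / 2) * logStar (Fintype.card V) + K ∧
      RunsIn (fun v => G.neighborFinset v) T
        (fun v => sv (Fintype.card V) G.maxDegree (ident v)) out ∧
      IsLegal (fun v => G.neighborFinset v) (64 * G.maxDegree ^ 2) out := by
  obtain ⟨T, hT, hrun⟩ := h (Fintype.card V) G.maxDegree hΔ
  obtain ⟨out, h1, h2⟩ := hrun V (fun v => G.neighborFinset v) ident G.isNetwork
    -- The identity numbers serve as the initial legal coloring.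
    ⟨fun v => Nat.lt_succ_of_le (hident.2 v), fun v u hu heq => by
      rw [hident.1 heq] at hu
      exact G.irrefl ((G.mem_neighborFinset _ _).1 hu)⟩
  exact ⟨T, out, hT, h1, h2⟩

theorem mainTheorem1 :
    ∃ c : ℕ, 0 < c ∧ ∀ a : ℕ, ∃ (sv : DistAlgorithm ℕ) (K : ℝ), IsSVAlgorithm c a K sv ∧
      ∀ ε : ℝ, 0 < ε → ε < 1 → ∃ C : ℝ,
        ∀ (V : Type) [Fintype V] (G : SimpleGraph V) [DecidableRel G.Adj] (ident : V → ℕ),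
          IsIdentAssignment a ident → 1 ≤ G.maxDegree →
          (∃ (T : ℕ) (out : V → ℕ),
            (T : ℝ) ≤ C * G.maxDegree + (1 / 2) * logStar (Fintype.card V) ∧
            (deltaColorAlgorithm c ε sv).RunsWithin G ident T out ∧
            IsLegalColoring G (G.maxDegree + 1) out) ∧
          (∃ (T : ℕ) (out : V → Bool),
            (T : ℝ) ≤ C * G.maxDegree + (1 / 2) * logStar (Fintype.card V) ∧
            (misAlgorithm c ε sv).RunsWithin G ident T out ∧
            IsMIS G {v | out v = true}) := by
  refine ⟨64, by norm_num, fun a => ?_⟩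
  obtain ⟨sv, hsv⟩ := exists_svAlgorithm a
  set K : ℝ := a / 2 + 8 with hK
  have hK0 : 0 ≤ K := by positivity
  refine ⟨sv, K, fun V _ G _ ident hident hΔ => ?_, fun ε hε0 hε1 => ?_⟩
  · obtain ⟨T, out, hT, hrun, hlegal⟩ := isSVAlgorithm_of_forall hsv hident hΔ
    exact ⟨T, out, hT, hrun.iterate_networkRound, (isLegal_neighborFinset_iff G out).1 hlegal⟩
  obtain ⟨C, hC0, hC⟩ := exists_deltaTime_logStar_le hε0 hε1 (c := 64) (by norm_num)
  -- As `Δ ≥ 1`, the constant `K` is at most `K * Δ` and the `Δ + 1` rounds of Linial's reduction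
  -- are at most `2 * Δ`.
  refine ⟨K + C + 2, fun V _ G _ ident hident hΔ => ?_⟩
  have hN := G.isNetwork
  obtain ⟨T, ψ, hT, hrun, hψ⟩ := isSVAlgorithm_of_forall hsv hident hΔ
  obtain ⟨φ, hφrun, hφ⟩ := exists_runsIn_deltaColor hε0 hε1 (logStar G.maxDegree) hN hψ
  obtain ⟨I, hIrun, hind, hmax⟩ := exists_runsIn_misFromColoring hN hφ
  have hcolor : RunsIn (fun v => G.neighborFinset v)
      (T + deltaTime 64 ε (logStar G.maxDegree) G.maxDegree)
      (fun v => deltaColorAlgorithm 64 ε sv (Fintype.card V) G.maxDegree (ident v)) φ :=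
    hrun.bind (f := fun _ => deltaColor 64 ε (logStar G.maxDegree) G.maxDegree) hφrun
  have hmis : RunsIn (fun v => G.neighborFinset v)
      (T + deltaTime 64 ε (logStar G.maxDegree) G.maxDegree + (G.maxDegree + 1))
      (fun v => misAlgorithm 64 ε sv (Fintype.card V) G.maxDegree (ident v)) I :=
    hcolor.bind (f := fun _ => misFromColoring G.maxDegree) hIrun
  have hΔR : (1 : ℝ) ≤ G.maxDegree := by exact_mod_cast hΔ
  have htime := hC G.maxDegree hΔ
  refine ⟨⟨_, φ, ?_, hcolor.iterate_networkRound, (isLegal_neighborFinset_iff G φ).1 hφ⟩,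
    ⟨_, I, ?_, hmis.iterate_networkRound, fun u w huw => ?_, fun v => ?_⟩⟩
  · push_cast
    nlinarith
  · push_cast
    nlinarith
  · by_cases hu : I u = true
    · right
      simp [hind w u ((G.mem_neighborFinset _ _).2 huw.symm) hu]
    · exact Or.inl hu
  · rcases hmax v with h | ⟨u, hu, h⟩
    · exact Or.inl h
    · exact Or.inr ⟨u, (G.mem_neighborFinset _ _).1 hu, h⟩
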